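/- **Setting.** Let $\Upsilon=(0,\infty)$ and $\Omega=\Upsilon^{\mathbb N}\times\Upsilon^{\mathbb N}\times\Upsilon$ with its Borel $\sigma$-algebra $\Sigma$. For $n\ge1$ let $W_n$ and $X_n$ be the $n$-th coordinates of the first and of the second factor, and let $\Theta$ be the projection onto the last factor; write $W=(W_n)$, $X=(X_n)$. Put $T_n=\sum_{k=1}^n W_k$, $N_t=\sum_{n\ge0}n\,\chi_{\{T_n\le t<T_{n+1}\}}$, $S_t=\sum_{k=1}^{N_t}X_k$ for $t\ge0$, and $\mathcal F_t=\sigma(\Theta,\,S_u: u\le t)$. Images of a measure $Q$ are written $Q_\Theta$, $Q_{X_1}$. Two measures are *progressively equivalent* if they have the same null sets in $\mathcal F_t$ for every $t\ge0$. For a probability measure $Q$ on $\Sigma$, the pair $(N,X)$ is a *$Q$-risk process* if the explosion $\{\sup_nT_n<\infty\}$ is $Q$-null (so that $N$ is a counting process off a $Q$-null set), $X$ is $Q$-i.i.d., and $N$ and $X$ are $Q$-independent of each other. For measurable $g:\Upsilon\to\Upsilon$, $S$ is a *$Q$-CMPP$(g(\Theta),Q_{X_1})$* if $(N,X)$ is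 a $Q$-risk process, $N$ has conditionally stationary and conditionally independent increments given $\Theta$, and for each $t>0$ the conditional distribution of $N_t$ given $\Theta$ is Poisson with mean $t\,g(\Theta)$, $Q$-a.s. For $c>0$, $S$ is a *$Q$-CPP$(c,Q_{X_1})$* if $(N,X)$ is a $Q$-risk process and $N$ is a Poisson process with parameter $c$ under $Q$ (stationary independent increments, $N_t$ Poisson with mean $tc$). A *regular conditional probability (r.c.p.) of $Q$ over $Q_\Theta$ consistent with $\Theta$* is a family $(Q_\theta)_{\theta\in\Upsilon}$ of probability measures on $\Sigma$ such that $\theta\mapsto Q_\theta(D)$ is measurable and $\int Q_\theta(D)\,Q_\Theta(d\theta)=Q(D)$ for every $D\in\Sigma$, and such that for every Borel $B\subseteq\Upsilon$ one has $Q_\theta(\Theta^{-1}(B))=1$ for $Q_\Theta$-almost all $\theta\in B$. Let $\ell\in\{1,2\}$ and let $P$ be a probability measure on $\Sigma$. For measurable $g:\Upsilon\to\Upsilon$ put: * $\mathcal M_{S,g}^{*,\ell}$: the class of probability measures $Q$ on $\Sigma$, progressively equivalent to $P$, such that $W$ and $X$ are $Q$-conditionally independent of each other given $\Theta$, $\Theta$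 and $X$ are $Q$-independent, $S$ is a $Q$-CMPP$(g(\Theta),Q_{X_1})$, $\mathbb E_Q[X_1^\ell]<\infty$ and $\mathbb E_Q[g(\Theta)^\ell]<\infty$. Put $\mathcal M_S^{*,\ell}=\mathcal M_{S,\mathrm{id}}^{*,\ell}$. * $\mathcal F_P^\ell$: the class of functions $\beta(x,\theta)=\alpha(\theta)+\gamma(x)$ on $\Upsilon\times\Upsilon$ with $\alpha,\gamma:\Upsilon\to\mathbb R$ measurable, $\mathbb E_P[e^{\gamma(X_1)}]=1$ and $\mathbb E_P[X_1^\ell e^{\gamma(X_1)}]<\infty$. (The normalization makes $\alpha$ and $\gamma$ unique for given $\beta$.) * $\mathcal R_{+}^{*,\ell}(\Upsilon;g)$: the class of measurable $\xi:\Upsilon\to\mathbb R$ with $P_\Theta(\xi>0)=1$, $\mathbb E_P[\xi(\Theta)]=1$ and $\mathbb E_P[\xi(\Theta)g(\Theta)^\ell]<\infty$. With $S_t^{(\beta)}(\theta)=\sum_{k=1}^{N_t}\beta(X_k,\theta)$ consider the conditions $(**)$ $\;g(\Theta)=\Theta e^{\alpha(\Theta)}$ everywhere on $\Omega$, and $\gamma=\ln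 f$ for a $P_{X_1}$-a.s. positive Radon–Nikodým derivative $f$ of $Q_{X_1}$ with respect to $P_{X_1}$ (with $\gamma=\ln f$ required where $f>0$); $(M_\xi)$ $\;Q(A)=\int_A \xi(\Theta)\,e^{S_t^{(\beta)}(\Theta)-t\Theta(e^{\alpha(\Theta)}-1)}\,dP$ for all $0\le s\le t$ and $A\in\mathcal F_s$; $(M_\theta)$ $\;Q_\theta(A)=\int_A e^{S_t^{(\beta)}(\theta)-t\theta(e^{\alpha(\theta)}-1)}\,dP_\theta$ for all $0\le s\le t$ and $A\in\mathcal F_s$. **Statement.** Let $\ell\in\{1,2\}$ and $P\in\mathcal M_S^{*,\ell}$, and let $(P_\theta)_{\theta\in\Upsilon}$ be an r.c.p. of $P$ over $P_\Theta$ consistent with $\Theta$. (i) For every measurable $g:\Upsilon\to\Upsilon$ and every $Q\in\mathcal M_{S,g}^{*,\ell}$ there is a pair $(\beta,\xi)\in\mathcal F_P^\ell\times\mathcal R_+^{*,\ell}(\Upsilon;g)$, with $\xi$ a Radon–Nikodým derivative of $Q_\Theta$ with respect to $P_\Theta$, satisfying $(**)$ and $(M_\xi)$. It is essentially unique: if $(\beta',\xi')\in\mathcal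 F_P^\ell\times\mathcal R_+^{*,\ell}(\Upsilon;g)$ also satisfies $(**)$ and $(M_\xi)$, then $\beta'=\beta$ $P_{X_1}\otimes P_\Theta$-a.e. and $\xi'=\xi$ $P_\Theta$-a.e. (ii) Conversely, for every $\beta\in\mathcal F_P^\ell$ and every $\xi\in\mathcal R_+^{*,\ell}(\Upsilon;\,\theta\mapsto\theta e^{\alpha(\theta)})$ there is exactly one pair $(g,Q)$ with $g:\Upsilon\to\Upsilon$ measurable and $Q\in\mathcal M_{S,g}^{*,\ell}$ that satisfies $(**)$ and $(M_\xi)$. (iii) In both cases, that is, whenever $g:\Upsilon\to\Upsilon$ is measurable, $Q\in\mathcal M_{S,g}^{*,\ell}$, $(\beta,\xi)\in\mathcal F_P^\ell\times\mathcal R_+^{*,\ell}(\Upsilon;g)$, and $(**)$ and $(M_\xi)$ hold, there is an r.c.p. $(Q_\theta)_{\theta\in\Upsilon}$ of $Q$ over $Q_\Theta$ consistent with $\Theta$, essentially unique in the sense that any other one agrees with it for $P_\Theta$-almost all $\theta$, and there is a Borel set $V_*\subseteq\Upsilon$ with $P_\Theta(V_*)=0$ such that for every $\theta\notin V_*$: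 $Q_\theta$ and $P_\theta$ are progressively equivalent, $S$ is a $Q_\theta$-CPP$(g(\theta),(Q_\theta)_{X_1})$, $\mathbb E_{Q_\theta}[X_1^\ell]<\infty$, and $(M_\theta)$ holds. -/

import Mathlib

open MeasureTheory ProbabilityTheory
open scoped NNReal ENNReal

noncomputable section

namespace CMPP

/-! ### The canonical space and its processes -/

/-- The open half-line `Υ = (0, ∞)`, with its Borel σ-algebra. -/
abbrev Pos : Type := Set.Ioi (0 : ℝ)

instance : StandardBorelSpace Pos := measurableSet_Ioi.standardBorel

instance : Nonempty Pos := ⟨⟨1, Set.mem_Ioi.mpr one_pos⟩⟩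

/-- The canonical space `Ω = Υ^ℕ × Υ^ℕ × Υ`, with its product (equivalently, Borel) σ-algebra.
A point is a triple (interarrival times, claim sizes, structure parameter). -/
abbrev Ω : Type := (ℕ → Pos) × (ℕ → Pos) × Pos

/-- The interarrival process. Sequences are indexed from `0`: `W n` is the `(n+1)`-st
interarrival time. -/
def W (n : ℕ) (ω : Ω) : Pos := ω.1 n

/-- The size process; `X n` is the size of the `(n+1)`-st claim, so `X 0` is the first one. -/
def X (n : ℕ) (ω : Ω) : Pos := ω.2.1 n

/-- The structure parameter. -/
def Θ (ω : Ω) : Pos := ω.2.2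

/-- The arrival process: `T 0 = 0` and `T n` is the sum of the first `n` interarrival times. -/
def T (n : ℕ) (ω : Ω) : ℝ := ∑ k ∈ Finset.range n, (W k ω : ℝ)

open Classical in
/-- The counting process `N_t = ∑ₙ n χ_{T_n ≤ t < T_{n+1}}`. At most one summand is nonzero. -/
def N (t : ℝ≥0) (ω : Ω) : ℕ :=
  ∑' n : ℕ, if T n ω ≤ (t : ℝ) ∧ (t : ℝ) < T (n + 1) ω then n else 0

/-- The aggregate process `S_t = X_1 + ⋯ + X_{N_t}`. -/
def S (t : ℝ≥0) (ω : Ω) : ℝ := ∑ k ∈ Finset.range (N t ω), (X k ω : ℝ)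

/-- The explosion `{sup_n T_n < ∞}`. Off this set the path `t ↦ N_t` is a counting path: it starts
at `0`, is right-continuous and unbounded, and it increases by jumps of size one. -/
def explosion : Set Ω := {ω | BddAbove (Set.range fun n => T n ω)}

/-- The canonical filtration of `S` and `Θ`: `F_t` is generated by `Θ` and all `S_u`, `u ≤ t`. -/
abbrev F (t : ℝ≥0) : MeasurableSpace Ω :=
  (⨆ u : ℝ≥0, ⨆ _ : u ≤ t, MeasurableSpace.comap (S u) inferInstance) ⊔
    MeasurableSpace.comap Θ inferInstance

lemma measurable_Θ : Measurable Θ := measurable_snd.comp measurable_snd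

/-- The σ-algebra `σ(Θ)`. -/
abbrev sigmaΘ : MeasurableSpace Ω := MeasurableSpace.comap Θ inferInstance

lemma sigmaΘ_le : sigmaΘ ≤ (inferInstance : MeasurableSpace Ω) := measurable_Θ.comap_le

/-- Progressive equivalence: `Q` and `P` have the same null sets in every `F_t`. -/
def ProgEquiv (Q P : Measure Ω) : Prop :=
  ∀ t : ℝ≥0, ∀ A : Set Ω, MeasurableSet[F t] A → (Q A = 0 ↔ P A = 0)

/-! ### Risk processes, (mixed) Poisson and compound (mixed) Poisson processes -/

/-- The sequences `W` and `X` are conditionally independent of each other given `Θ`. -/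
def CondA1 (Q : Measure Ω) [IsFiniteMeasure Q] : Prop :=
  CondIndepFun sigmaΘ sigmaΘ_le (fun ω n => W n ω) (fun ω n => X n ω) Q

/-- `Θ` and the sequence `X` are independent. -/
def CondA2 (Q : Measure Ω) : Prop := IndepFun Θ (fun ω n => X n ω) Q

/-- `(N, X)` is a `Q`-risk process: `N` is a counting process with a null exceptional set, `X` is
i.i.d., and the processes `N` and `X` are independent of each other. -/
structure IsRiskProcess (Q : Measure Ω) : Prop where
  explosion_null : Q explosion = 0
  indep_sizes : iIndepFun X Q
  ident_sizes : ∀ n, IdentDistrib (X n) (X 0) Q Q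
  indep : IndepFun (fun ω t => N t ω) (fun ω n => X n ω) Q

/-- A positive number as a nonnegative real. -/
def toNN (y : Pos) : ℝ≥0 := ⟨(y : ℝ), le_of_lt y.2⟩

/-- The increment `N_t - N_s`. -/
def incr (s t : ℝ≥0) (ω : Ω) : ℤ := (N t ω : ℤ) - (N s ω : ℤ)

/-- `N` is a `Q`-mixed Poisson process with parameter `g(Θ)`: conditionally given `Θ` it has
independent and stationary increments, and the conditional distribution of `N_t` given `Θ` is the
Poisson distribution with mean `t g(Θ)`. -/
structure IsMPP (Q : Measure Ω) [IsFiniteMeasure Q] (g : Pos → Pos) : Prop where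
  cond_indep : ∀ (m : ℕ) (t : Fin (m + 1) → ℝ≥0), Monotone t →
    iCondIndepFun sigmaΘ sigmaΘ_le (fun i : Fin m => incr (t i.castSucc) (t i.succ)) Q
  cond_stat : ∀ s t h : ℝ≥0, s ≤ t →
    ∀ᵐ θ ∂(Q.map Θ), condDistrib (incr (s + h) (t + h)) Θ Q θ = condDistrib (incr s t) Θ Q θ
  cond_poisson : ∀ t : ℝ≥0, 0 < t →
    ∀ᵐ θ ∂(Q.map Θ), condDistrib (N t) Θ Q θ = poissonMeasure (t * toNN (g θ))

/-- `S` is a `Q`-compound mixed Poisson process with parameters `g(Θ)` and `Q_{X_1}`. -/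
def IsCMPP (Q : Measure Ω) [IsFiniteMeasure Q] (g : Pos → Pos) : Prop :=
  IsRiskProcess Q ∧ IsMPP Q g

/-- `N` is a `Q`-Poisson process with parameter `c`. -/
structure IsPP (Q : Measure Ω) (c : Pos) : Prop where
  indep : HasIndepIncrements (fun t ω => (N t ω : ℤ)) Q
  stat : ∀ s t h : ℝ≥0, s ≤ t → Q.map (incr (s + h) (t + h)) = Q.map (incr s t)
  poisson : ∀ t : ℝ≥0, 0 < t → Q.map (N t) = poissonMeasure (t * toNN c)

/-- `S` is a `Q`-compound Poisson process with parameters `c` and `Q_{X_1}`. -/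
def IsCPP (Q : Measure Ω) (c : Pos) : Prop := IsRiskProcess Q ∧ IsPP Q c

/-! ### Regular conditional probabilities -/

/-- The kernel `κ`, `θ ↦ Q_θ`, is a regular conditional probability of `Q` over `Q_Θ` consistent
with `Θ`. -/
structure IsRCP (κ : Kernel Pos Ω) (Q : Measure Ω) : Prop where
  prob : ∀ θ, IsProbabilityMeasure (κ θ)
  disint : ∀ D : Set Ω, MeasurableSet D → ∫⁻ θ, κ θ D ∂(Q.map Θ) = Q D
  consistent : ∀ B : Set Pos, MeasurableSet B →
    ∀ᵐ θ ∂(Q.map Θ), θ ∈ B → κ θ (Θ ⁻¹' B) = 1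

/-! ### The classes of measures -/

/-- `M_{S,g}` (relative to `P`). -/
def classM (P : ProbabilityMeasure Ω) (g : Pos → Pos) : Set (ProbabilityMeasure Ω) :=
  {Q | CondA1 (Q : Measure Ω) ∧ CondA2 (Q : Measure Ω) ∧ ProgEquiv (Q : Measure Ω) P ∧
    IsCMPP (Q : Measure Ω) g}

/-- `M_{S,g}^{*,ℓ}`: those `Q ∈ M_{S,g}` with `E_Q[X_1^ℓ] < ∞` and `E_Q[g(Θ)^ℓ] < ∞`. -/
def classMStar (P : ProbabilityMeasure Ω) (g : Pos → Pos) (ℓ : ℕ) :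
    Set (ProbabilityMeasure Ω) :=
  {Q | Q ∈ classM P g ∧
    Integrable (fun ω => (X 0 ω : ℝ) ^ ℓ) (Q : Measure Ω) ∧
    Integrable (fun ω => (g (Θ ω) : ℝ) ^ ℓ) (Q : Measure Ω)}

/-- The fibrewise class of `Q_θ` such that `Q_θ` and `P_θ` are progressively equivalent, `S` is a
`Q_θ`-compound Poisson process with parameters `c = g(θ)` and `(Q_θ)_{X_1}`, and
`E_{Q_θ}[X_1^ℓ] < ∞`. -/
def fibreClass (Pθ : Measure Ω) (c : Pos) (ℓ : ℕ) : Set (Measure Ω) :=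
  {Qθ | IsProbabilityMeasure Qθ ∧ ProgEquiv Qθ Pθ ∧ IsCPP Qθ c ∧
    Integrable (fun ω => (X 0 ω : ℝ) ^ ℓ) Qθ}

/-! ### The classes of functions -/

/-- An element `β` of `F_P`, given by its summands: `β(x, θ) = α(θ) + γ(x)` with measurable `α`, `γ`
such that `E_P[exp γ(X_1)] = 1`. The summands are determined by the function `β`, see
`ClassF.summands_unique`. -/
structure ClassF (P : ProbabilityMeasure Ω) where
  α : Pos → ℝ
  γ : Pos → ℝ
  measurable_α : Measurable α
  measurable_γ : Measurable γ
  normalized : ∫ ω, Real.exp (γ (X 0 ω)) ∂(P : Measure Ω) = 1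

namespace ClassF

variable {P : ProbabilityMeasure Ω}

/-- The function `β(x, θ) = α(θ) + γ(x)`. -/
def β (b : ClassF P) (p : Pos × Pos) : ℝ := b.α p.2 + b.γ p.1

theorem summands_unique (b b' : ClassF P) (h : b.β = b'.β) : b = b' := by
  have key : ∀ x θ, b.α θ + b.γ x = b'.α θ + b'.γ x := fun x θ => congrFun h (x, θ)
  let o : Pos := ⟨1, Set.mem_Ioi.mpr one_pos⟩
  have hγ : ∀ x, b'.γ x = (b.α o - b'.α o) + b.γ x := fun x => by linarith [key x o]
  have h1 := b'.normalized
  simp only [hγ, Real.exp_add, integral_const_mul, b.normalized, mul_one] at h1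
  have h0 : b.α o - b'.α o = 0 := by simpa using h1
  have hγ' : b.γ = b'.γ := funext fun x => by rw [hγ x, h0, zero_add]
  have hα' : b.α = b'.α := funext fun θ => by
    have := key o θ
    rw [hγ'] at this
    linarith
  cases b
  cases b'
  simp_all

/-- Membership in `F_P^ℓ`: `E_P[X_1^ℓ exp γ(X_1)] < ∞`. -/
def MemL (b : ClassF P) (ℓ : ℕ) : Prop :=
  Integrable (fun ω => (X 0 ω : ℝ) ^ ℓ * Real.exp (b.γ (X 0 ω))) (P : Measure Ω)

/-- The function `θ ↦ θ exp α(θ)`. -/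
def param (b : ClassF P) (θ : Pos) : Pos :=
  ⟨(θ : ℝ) * Real.exp (b.α θ), mul_pos θ.2 (Real.exp_pos _)⟩

/-- `S_t^{(β)}(θ) = ∑_{k=1}^{N_t} β(X_k, θ)`. -/
def sumβ (b : ClassF P) (t : ℝ≥0) (θ : Pos) (ω : Ω) : ℝ :=
  ∑ k ∈ Finset.range (N t ω), b.β (X k ω, θ)

/-- The fibrewise density `exp (S_t^{(β)}(θ) - t θ (exp α(θ) - 1))`. -/
def density (b : ClassF P) (t : ℝ≥0) (θ : Pos) (ω : Ω) : ℝ :=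
  Real.exp (b.sumβ t θ ω - (t : ℝ) * (θ : ℝ) * (Real.exp (b.α θ) - 1))

end ClassF

/-- `R_+^{*,ℓ}(Υ)`, formed with `g`: measurable `ξ` with `P_Θ(ξ > 0) = 1`, `E_P[ξ(Θ)] = 1` and
`E_P[ξ(Θ) g(Θ)^ℓ] < ∞`. -/
def classRStar (P : ProbabilityMeasure Ω) (g : Pos → Pos) (ℓ : ℕ) : Set (Pos → ℝ) :=
  {ξ | Measurable ξ ∧ (∀ᵐ θ ∂((P : Measure Ω).map Θ), 0 < ξ θ) ∧
    ∫ ω, ξ (Θ ω) ∂(P : Measure Ω) = 1 ∧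
    Integrable (fun ω => ξ (Θ ω) * (g (Θ ω) : ℝ) ^ ℓ) (P : Measure Ω)}

/-- `f` is a Radon-Nikodým derivative of `ν` with respect to `μ`, for `μ`-a.e. nonnegative `f`. -/
def IsRNDeriv (f : Pos → ℝ) (ν μ : Measure Pos) : Prop :=
  Measurable f ∧ (∀ᵐ x ∂μ, 0 ≤ f x) ∧ ν = μ.withDensity fun x => ENNReal.ofReal (f x)

/-! ### The conditions linking `(g, Q)` and `(β, ξ)` -/

/-- Condition `(**)`: `g(Θ) = Θ exp α(Θ)` and `γ = ln f` for a `P_{X_1}`-a.s. positive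
Radon-Nikodým derivative `f` of `Q_{X_1}` with respect to `P_{X_1}`. -/
def StarStar {P : ProbabilityMeasure Ω} (g : Pos → Pos) (Q : ProbabilityMeasure Ω)
    (b : ClassF P) : Prop :=
  (∀ ω : Ω, (g (Θ ω) : ℝ) = (Θ ω : ℝ) * Real.exp (b.α (Θ ω))) ∧
  ∃ f : Pos → ℝ, IsRNDeriv f ((Q : Measure Ω).map (X 0)) ((P : Measure Ω).map (X 0)) ∧
    (∀ᵐ x ∂((P : Measure Ω).map (X 0)), 0 < f x) ∧
    ∀ x, 0 < f x → b.γ x = Real.log (f x)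

/-- Condition `(M_ξ)`: `Q(A) = ∫_A ξ(Θ) exp (S_t^{(β)}(Θ) - t Θ (exp α(Θ) - 1)) dP` for all
`s ≤ t` and `A ∈ F_s`. -/
def MXi {P : ProbabilityMeasure Ω} (Q : ProbabilityMeasure Ω) (b : ClassF P)
    (ξ : Pos → ℝ) : Prop :=
  ∀ s t : ℝ≥0, s ≤ t → ∀ A : Set Ω, MeasurableSet[F s] A →
    (Q : Measure Ω) A =
      ∫⁻ ω in A, ENNReal.ofReal (ξ (Θ ω) * b.density t (Θ ω) ω) ∂(P : Measure Ω)

/-- Condition `(M_θ)`: `Q_θ(A) = ∫_A exp (S_t^{(β)}(θ) - t θ (exp α(θ) - 1)) dP_θ` for all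
`s ≤ t` and `A ∈ F_s`. -/
def MTheta {P : ProbabilityMeasure Ω} (Pθ Qθ : Measure Ω) (b : ClassF P) (θ : Pos) : Prop :=
  ∀ s t : ℝ≥0, s ≤ t → ∀ A : Set Ω, MeasurableSet[F s] A →
    Qθ A = ∫⁻ ω in A, ENNReal.ofReal (b.density t θ ω) ∂Pθ

end CMPP

end

open CMPP

noncomputable section

namespace CMPP

/-! Conditionally on `Θ = θ`, a member `Q` of the class has i.i.d. exponential interarrival times of
rate `g θ` and, independently of them, i.i.d. claims of law `ν = Q_{X_1}`. So `Q` is the mixture of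
the explicit laws `fib (g θ) ν θ` over `Q_Θ` (`eq_mixture_of_mem_classM`), and `g`, `Q_{X_1}` and
`Q_Θ` determine it. The theorem encodes these three data by `α = log (g θ / θ)`, `γ = log
(dQ_{X_1}/dP_{X_1})` and `ξ = dQ_Θ/dP_Θ`.

The mixture representation has two halves. Mixtures have the defining properties because a path with
exponential interarrival times restarts afresh at every time (`lintegral_shift`), so that its
counting process is Poisson (`expLaw_increments`). Conversely, conditionally independent Poisson
increments fix the joint law of `Θ` and of `N` on dyadic grids; the arrival times are read off from
these outside the explosion (`IsMPP.map_path_eq`), and the claims enter as an independent factor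
(`apply_box_eq_mul`).

For the densities, an event of `F t` on `{N_t = n}` involves only `Θ`, the first `n` interarrival
times and the first `n` claims (`exists_trunc_of_measurableSet_F`). There the likelihood ratio of
two fibre laws is `(c/c')^n exp(-(c-c')t) ∏ exp γ(X_k)` with `c = θ exp α(θ)` and `c' = θ`, which is
the exponential in `(M_θ)` (`fib_apply_of_measurableSet_F`). Integration against `ξ dP_Θ` gives
`(M_ξ)`.

The existence of `γ` needs `Q_{X_1}` and `P_{X_1}` to be equivalent, although equivalence is given
only on each `F t`; the first claim is visible there as the first nonzero value of `S`
(`map_X_absolutelyContinuous`). For uniqueness, `(M_ξ)` at time `0` identifies `ξ`, and `(**)`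
identifies `α` and `γ`. For the fibrewise statement, the explicit kernel is an r.c.p. of `Q`, and
any r.c.p. of `P` agrees almost everywhere with the explicit one (`IsRCP.unique`). -/

/-! ### Deterministic facts about counting paths -/

/-- A sequence of interarrival times. -/
abbrev Path : Type := ℕ → Pos

/-- The arrival times of a path. -/
def arrival (n : ℕ) (w : Path) : ℝ := ∑ k ∈ Finset.range n, (w k : ℝ)

/-- The paths having exactly `n` arrivals up to time `t`. -/
def atLevel (n : ℕ) (t : ℝ) : Set Path := {w | arrival n w ≤ t ∧ t < arrival (n + 1) w}

open Classical in
/-- The counting function of a path. -/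
def count (t : ℝ≥0) (w : Path) : ℕ :=
  ∑' n : ℕ, if arrival n w ≤ (t : ℝ) ∧ (t : ℝ) < arrival (n + 1) w then n else 0

/-- The paths whose arrival times accumulate. -/
def explosive : Set Path := {w | BddAbove (Set.range fun n => arrival n w)}

lemma N_eq (t : ℝ≥0) (ω : Ω) : N t ω = count t ω.1 := rfl

lemma explosion_eq : explosion = Prod.fst ⁻¹' explosive := rfl

@[simp] lemma arrival_zero (w : Path) : arrival 0 w = 0 := by simp [arrival]

lemma arrival_succ (n : ℕ) (w : Path) : arrival (n + 1) w = arrival n w + w n := by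
  simp [arrival, Finset.sum_range_succ]

lemma arrival_strictMono (w : Path) : StrictMono fun n => arrival n w :=
  strictMono_nat_of_lt_succ fun n => by
    rw [arrival_succ]
    have := (w n).2
    simp only [Set.mem_Ioi] at this
    linarith

lemma arrival_mono (w : Path) {m n : ℕ} (h : m ≤ n) : arrival m w ≤ arrival n w :=
  (arrival_strictMono w).monotone h

lemma arrival_nonneg (n : ℕ) (w : Path) : 0 ≤ arrival n w := by
  simpa using arrival_mono w (Nat.zero_le n)

lemma atLevel_unique {m n : ℕ} {t : ℝ} {w : Path} (hm : w ∈ atLevel m t) (hn : w ∈ atLevel n t) :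
    m = n := by
  by_contra h
  rcases lt_or_gt_of_ne h with h | h
  · have := arrival_mono w (show m + 1 ≤ n from h)
    have h1 := hm.2
    have h2 := hn.1
    linarith
  · have := arrival_mono w (show n + 1 ≤ m from h)
    have h1 := hn.2
    have h2 := hm.1
    linarith

lemma count_of_mem {n : ℕ} {t : ℝ≥0} {w : Path} (h : w ∈ atLevel n t) : count t w = n := by
  unfold count
  rw [tsum_eq_single n]
  · exact if_pos h
  · intro m hm
    exact if_neg fun h' => hm (atLevel_unique h' h)

lemma count_of_forall_notMem {t : ℝ≥0} {w : Path} (h : ∀ n, w ∉ atLevel n t) : count t w = 0 := by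
  unfold count
  exact (tsum_congr fun n => if_neg (h n)).trans tsum_zero

lemma mem_atLevel_zero_zero (w : Path) : w ∈ atLevel 0 0 :=
  ⟨by simp, by simpa using (arrival_strictMono w) Nat.zero_lt_one⟩

lemma count_zero (w : Path) : count 0 w = 0 :=
  count_of_mem (by simpa using mem_atLevel_zero_zero w)

lemma exists_mem_atLevel_of_lt {w : Path} {t : ℝ} (ht : 0 ≤ t) (hex : ∃ n, t < arrival n w) :
    ∃ n, w ∈ atLevel n t := by
  classical
  obtain ⟨m, hm⟩ : ∃ m, Nat.find hex = m + 1 := by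
    refine Nat.exists_eq_succ_of_ne_zero fun h0 => ?_
    have := Nat.find_spec hex
    rw [h0, arrival_zero] at this
    linarith
  refine ⟨m, ?_, ?_⟩
  · exact not_lt.mp (Nat.find_min hex (by omega))
  · have := Nat.find_spec hex
    rwa [hm] at this

lemma exists_mem_atLevel {w : Path} (hw : w ∉ explosive) {t : ℝ} (ht : 0 ≤ t) :
    ∃ n, w ∈ atLevel n t := by
  refine exists_mem_atLevel_of_lt ht ?_
  by_contra! h
  exact hw ⟨t, by rintro _ ⟨n, rfl⟩; exact h n⟩

lemma mem_atLevel_count {w : Path} (hw : w ∉ explosive) (t : ℝ≥0) : w ∈ atLevel (count t w) t := by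
  obtain ⟨n, hn⟩ := exists_mem_atLevel hw t.2
  rw [count_of_mem (t := t) hn]
  exact hn

lemma le_count_iff {w : Path} (hw : w ∉ explosive) (t : ℝ≥0) (n : ℕ) :
    n ≤ count t w ↔ arrival n w ≤ t := by
  have h := mem_atLevel_count hw t
  constructor
  · intro hn
    exact (arrival_mono w hn).trans h.1
  · intro hn
    by_contra! hlt
    have := arrival_mono w (show count t w + 1 ≤ n from hlt)
    have h2 := h.2
    linarith

lemma measurable_arrival (n : ℕ) : Measurable (arrival n) := by
  unfold arrival
  fun_prop

lemma measurableSet_atLevel (n : ℕ) (t : ℝ) : MeasurableSet (atLevel n t) :=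
  (measurableSet_le (measurable_arrival n) measurable_const).inter
    (measurableSet_lt measurable_const (measurable_arrival (n + 1)))

lemma measurable_count (t : ℝ≥0) : Measurable (count t) := by
  refine measurable_to_countable' fun n => ?_
  -- The sum defining `count` is `0` when the path is at no level at time `t`, as after an
  -- explosion; the fibre over `0` therefore has a second piece.
  have : count t ⁻¹' {n} = atLevel n t ∪ (if n = 0 then ⋂ m, (atLevel m t)ᶜ else ∅) := by
    ext w
    simp only [Set.mem_preimage, Set.mem_singleton_iff, Set.mem_union]
    constructor
    · intro h
      by_cases hw : ∃ m, w ∈ atLevel m t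
      · obtain ⟨m, hm⟩ := hw
        left
        rwa [← h, count_of_mem hm]
      · push Not at hw
        right
        rw [count_of_forall_notMem hw] at h
        simpa [← h] using hw
    · rintro (h | h)
      · exact count_of_mem h
      · split_ifs at h with h0
        · rw [h0]
          exact count_of_forall_notMem (by simpa using h)
        · exact h.elim
  rw [this]
  refine (measurableSet_atLevel n t).union ?_
  split_ifs
  · exact MeasurableSet.iInter fun m => (measurableSet_atLevel m t).compl
  · exact MeasurableSet.empty

lemma measurableSet_explosive : MeasurableSet explosive := by
  have : explosive = ⋃ M : ℕ, ⋂ n, {w | arrival n w ≤ M} := by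
    ext w
    simp only [explosive, Set.mem_ofPred_eq, Set.mem_iUnion, Set.mem_iInter]
    constructor
    · rintro ⟨b, hb⟩
      obtain ⟨M, hM⟩ := exists_nat_ge b
      exact ⟨M, fun n => (hb ⟨n, rfl⟩).trans hM⟩
    · rintro ⟨M, hM⟩
      exact ⟨M, by rintro _ ⟨n, rfl⟩; exact hM n⟩
  rw [this]
  exact MeasurableSet.iUnion fun M => MeasurableSet.iInter fun n =>
    measurableSet_le (measurable_arrival n) measurable_const

/-! ### Removing the first arrival and restarting at a fixed time -/

/-- Put a value in front of a sequence. -/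
def cons {α : Type*} (a : α) (w : ℕ → α) : ℕ → α := fun n => Nat.casesOn n a w

@[simp] lemma cons_zero {α : Type*} (a : α) (w : ℕ → α) : cons a w 0 = a := rfl

@[simp] lemma cons_succ {α : Type*} (a : α) (w : ℕ → α) (n : ℕ) : cons a w (n + 1) = w n := rfl

lemma measurable_cons {α : Type*} [MeasurableSpace α] :
    Measurable fun p : α × (ℕ → α) => cons p.1 p.2 := by
  refine measurable_pi_lambda _ fun n => ?_
  cases n with
  | zero => exact measurable_fst
  | succ n => exact (measurable_pi_apply n).comp measurable_snd

lemma arrival_cons (n : ℕ) (a : Pos) (w : Path) :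
    arrival (n + 1) (cons a w) = a + arrival n w := by
  simp [arrival, Finset.sum_range_succ', add_comm]

lemma cons_mem_atLevel_succ {n : ℕ} {t : ℝ} {a : Pos} {w : Path} :
    cons a w ∈ atLevel (n + 1) t ↔ w ∈ atLevel n (t - a) := by
  simp only [atLevel, Set.mem_ofPred_eq, arrival_cons]
  constructor <;> rintro ⟨h1, h2⟩ <;> constructor <;> linarith

lemma cons_mem_atLevel_zero {t : ℝ} (ht : 0 ≤ t) {a : Pos} {w : Path} :
    cons a w ∈ atLevel 0 t ↔ t < a := by
  simp [atLevel, arrival_cons, ht]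

lemma notMem_atLevel_of_neg {n : ℕ} {t : ℝ} (ht : t < 0) (w : Path) : w ∉ atLevel n t :=
  fun h => absurd (h.1.trans_lt ht) (not_lt.mpr (arrival_nonneg n w))

/-- The positive number `x`, with junk value `1` for `x ≤ 0`. -/
def toPos (x : ℝ) : Pos := if h : 0 < x then ⟨x, h⟩ else ⟨1, Set.mem_Ioi.mpr one_pos⟩

lemma toPos_of_pos {x : ℝ} (h : 0 < x) : (toPos x : ℝ) = x := by simp [toPos, h]

@[simp] lemma toPos_coe (x : Pos) : toPos (x : ℝ) = x := Subtype.ext (toPos_of_pos x.2)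

lemma measurable_toPos : Measurable toPos :=
  Measurable.dite (s := {x : ℝ | 0 < x}) (f := fun x => (⟨x.1, x.2⟩ : Pos))
    (g := fun _ => (⟨1, Set.mem_Ioi.mpr one_pos⟩ : Pos))
    (measurable_subtype_coe.subtype_mk) measurable_const measurableSet_Ioi

/-- The interarrival times after time `t` of a path having `n` arrivals up to time `t`. -/
def shift (n : ℕ) (t : ℝ) (w : Path) : Path :=
  cons (toPos (arrival (n + 1) w - t)) fun k => w (n + 1 + k)

lemma measurable_shift (n : ℕ) (t : ℝ) : Measurable (shift n t) :=
  measurable_cons.comp ((measurable_toPos.comp ((measurable_arrival _).sub_const t)).prodMk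
    (measurable_pi_lambda _ fun _ => measurable_pi_apply _))

/-- Dropping the first arrival and setting the clock back by it commutes with restarting; this
drives the induction on the level in `lintegral_shift`. -/
lemma shift_succ_cons (n : ℕ) (t : ℝ) (a : Pos) (w : Path) :
    shift (n + 1) t (cons a w) = shift n (t - a) w := by
  unfold shift
  congr 1
  · rw [arrival_cons]
    congr 1
    ring
  · funext k
    rw [show n + 1 + 1 + k = n + 1 + k + 1 by ring, cons_succ]

lemma shift_zero_cons (t : ℝ) (a : Pos) (w : Path) :
    shift 0 t (cons a w) = cons (toPos (a - t)) w := by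
  unfold shift
  congr 1
  · simp [arrival_cons]
  · funext k
    rw [show 0 + 1 + k = k + 1 by ring, cons_succ]

/-- At level `n` the residual time is positive, so `toPos` gives no junk value. The index starts at
`1` because arrival `0` of the shifted path is `0`, whereas `arrival n w - t` may be negative. -/
lemma arrival_shift {n : ℕ} {t : ℝ} {w : Path} (h : w ∈ atLevel n t) (k : ℕ) :
    arrival (k + 1) (shift n t w) = arrival (n + (k + 1)) w - t := by
  induction k with
  | zero =>
    rw [shift, arrival_cons, arrival_zero, toPos_of_pos (sub_pos.mpr h.2)]
    ring_nf
  | succ k ih =>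
    rw [arrival_succ, ih, ← add_assoc n (k + 1) 1, arrival_succ (n + (k + 1))]
    rw [shift, cons_succ, show n + 1 + k = n + (k + 1) by ring]
    ring

lemma shift_mem_atLevel_iff {n m : ℕ} {t s : ℝ} (hs : 0 ≤ s) {w : Path} (h : w ∈ atLevel n t) :
    shift n t w ∈ atLevel m s ↔ w ∈ atLevel (n + m) (t + s) := by
  cases m with
  | zero =>
    simp only [atLevel, Set.mem_ofPred_eq, arrival_zero, add_zero, arrival_shift h 0, hs, true_and]
    have h1 := h.1
    constructor
    · intro h2
      rw [zero_add] at h2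
      constructor <;> linarith
    · rintro ⟨_, h2⟩
      rw [zero_add]
      linarith
  | succ m =>
    simp only [atLevel, Set.mem_ofPred_eq]
    rw [arrival_shift h, arrival_shift h]
    rw [show n + (m + 1) + 1 = n + (m + 1 + 1) by ring]
    constructor <;> rintro ⟨h1, h2⟩ <;> constructor <;> linarith

lemma shift_notMem_explosive {n : ℕ} {t : ℝ} {w : Path} (h : w ∈ atLevel n t)
    (hw : w ∉ explosive) : shift n t w ∉ explosive := by
  rintro ⟨b, hb⟩
  refine hw ⟨b + t, ?_⟩
  rintro _ ⟨k, rfl⟩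
  have h1 : arrival (k + 1) (shift n t w) ≤ b := hb ⟨k + 1, rfl⟩
  rw [arrival_shift h] at h1
  have h2 := arrival_mono w (show k ≤ n + (k + 1) by omega)
  linarith

/-- The deterministic half of the independence of increments: after `t` the path counts like its
shift. The probabilistic half is `lintegral_shift`. -/
lemma count_add {n : ℕ} {t s : ℝ≥0} {w : Path} (h : w ∈ atLevel n t) (hw : w ∉ explosive) :
    count (t + s) w = n + count s (shift n t w) := by
  have h1 := mem_atLevel_count (shift_notMem_explosive h hw) s
  rw [shift_mem_atLevel_iff (NNReal.coe_nonneg s) h] at h1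
  exact count_of_mem (by simpa using h1)

/-! ### Sequences of independent exponential variables -/

/-- Peeling off the first coordinate of an infinite product of copies of one measure. -/
lemma map_cons_infinitePi {α : Type*} [MeasurableSpace α] (μ : Measure α)
    [IsProbabilityMeasure μ] :
    (μ.prod (Measure.infinitePi fun _ : ℕ => μ)).map (fun p => cons p.1 p.2) =
      Measure.infinitePi fun _ : ℕ => μ := by
  classical
  refine Measure.eq_infinitePi _ fun s t ht => ?_
  rw [Measure.map_apply measurable_cons (MeasurableSet.pi s.countable_toSet fun i _ => ht i)]
  obtain ⟨m, hm⟩ : ∃ m, s ⊆ Finset.range (m + 1) :=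
    ⟨s.sup id, fun i hi => Finset.mem_range.mpr (Nat.lt_succ_of_le (Finset.le_sup (f := id) hi))⟩
  -- Padding with `univ` turns a cylinder over an arbitrary finite index set into one over an
  -- initial segment, from which the index `0` can be split off.
  set t' : ℕ → Set α := fun i => if i ∈ s then t i else Set.univ with ht'
  have hmt' : ∀ i, MeasurableSet (t' i) := fun i => by
    simp only [ht']
    split_ifs
    exacts [ht i, MeasurableSet.univ]
  have hpre : (fun p : α × (ℕ → α) => cons p.1 p.2) ⁻¹' Set.pi s t =
      t' 0 ×ˢ Set.pi (Finset.range m) fun k => t' (k + 1) := by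
    ext ⟨a, w⟩
    simp only [Set.mem_preimage, Set.mem_pi, Set.mem_prod, ht', Finset.mem_coe, Finset.mem_range]
    constructor
    · intro h
      refine ⟨?_, fun k _ => ?_⟩
      · split_ifs with h0
        exacts [h 0 h0, trivial]
      · split_ifs with h0
        exacts [h _ h0, trivial]
    · rintro ⟨h0, h1⟩ i hi
      cases i with
      | zero => simpa [hi] using h0
      | succ k =>
        have := h1 k (by have := hm hi; simp at this; omega)
        simpa [hi] using this
  rw [hpre, Measure.prod_prod, Measure.infinitePi_pi _ fun i _ => hmt' _]
  rw [mul_comm, ← Finset.prod_range_succ' (fun i => μ (t' i)) m,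
    ← Finset.prod_subset hm (fun i _ hi => by simp [ht', hi])]
  exact Finset.prod_congr rfl fun i hi => by simp [ht', hi]

lemma lintegral_infinitePi_cons {α : Type*} [MeasurableSpace α] (μ : Measure α)
    [IsProbabilityMeasure μ] {φ : (ℕ → α) → ℝ≥0∞} (hφ : Measurable φ) :
    ∫⁻ w, φ w ∂(Measure.infinitePi fun _ : ℕ => μ) =
      ∫⁻ a, ∫⁻ w, φ (cons a w) ∂(Measure.infinitePi fun _ : ℕ => μ) ∂μ := by
  conv_lhs => rw [← map_cons_infinitePi μ]
  rw [lintegral_map hφ measurable_cons, lintegral_prod]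
  exact (hφ.comp measurable_cons).aemeasurable

/-- The exponential distribution on the open half-line. -/
def expPos (c : Pos) : Measure Pos :=
  (Measure.comap Subtype.val (volume : Measure ℝ)).withDensity fun x =>
    ENNReal.ofReal (c * Real.exp (-(c * x)))

lemma lintegral_expPos (c : Pos) {φ : Pos → ℝ≥0∞} (hφ : Measurable φ) :
    ∫⁻ x, φ x ∂expPos c =
      ∫⁻ x in Set.Ioi (0 : ℝ), ENNReal.ofReal (c * Real.exp (-(c * x))) * φ (toPos x) := by
  rw [← lintegral_subtype_comap measurableSet_Ioi, expPos,
    lintegral_withDensity_eq_lintegral_mul _ (by fun_prop) hφ]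
  simp

lemma lintegral_exp_Ioi (c : Pos) :
    ∫⁻ x in Set.Ioi (0 : ℝ), ENNReal.ofReal (c * Real.exp (-(c * x))) = 1 := by
  have hc : 0 < (c : ℝ) := c.2
  rw [← ofReal_integral_eq_lintegral_ofReal]
  · rw [integral_const_mul]
    simp_rw [← neg_mul]
    rw [integral_exp_mul_Ioi (by linarith)]
    simp [hc.ne']
  · refine Integrable.const_mul ?_ _
    simp_rw [← neg_mul]
    exact exp_neg_integrableOn_Ioi 0 hc
  · exact Filter.Eventually.of_forall fun x => by positivity

instance isProbabilityMeasure_expPos (c : Pos) : IsProbabilityMeasure (expPos c) := by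
  constructor
  rw [← lintegral_one, lintegral_expPos c measurable_const]
  simpa using lintegral_exp_Ioi c

lemma lintegral_expPos_memoryless (c : Pos) {t : ℝ} (ht : 0 ≤ t) {φ : Pos → ℝ≥0∞}
    (hφ : Measurable φ) :
    ∫⁻ x, {x : Pos | t < x}.indicator (fun x => φ (toPos (x - t))) x ∂expPos c =
      ENNReal.ofReal (Real.exp (-(c * t))) * ∫⁻ x, φ x ∂expPos c := by
  have hms : MeasurableSet {x : Pos | t < x} :=
    measurableSet_lt measurable_const measurable_subtype_coe
  have hm : Measurable ({x : Pos | t < x}.indicator fun x => φ (toPos (x - t))) :=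
    (hφ.comp (measurable_toPos.comp (measurable_subtype_coe.sub_const t))).indicator hms
  rw [lintegral_expPos c hm, lintegral_expPos c hφ,
    ← lintegral_indicator measurableSet_Ioi, ← lintegral_indicator measurableSet_Ioi,
    ← lintegral_const_mul]
  · symm
    -- Memorylessness is a translation by `t`. Lebesgue measure is translation invariant only on the
    -- whole line, so both integrals have been extended by indicators.
    rw [← lintegral_sub_right_eq_self _ t]
    refine lintegral_congr fun x => ?_
    symm
    by_cases hx : t < x
    · have hx0 : 0 < x := ht.trans_lt hx
      rw [Set.indicator_of_mem (show x ∈ Set.Ioi 0 from hx0),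
        Set.indicator_of_mem (show x - t ∈ Set.Ioi 0 from sub_pos.mpr hx),
        Set.indicator_of_mem (by simpa [toPos_of_pos hx0] using hx), ← mul_assoc,
        ← ENNReal.ofReal_mul (by positivity), toPos_of_pos hx0]
      congr 2
      rw [mul_left_comm, ← Real.exp_add]
      ring_nf
    · have h2 : x - t ∉ Set.Ioi (0 : ℝ) := by simpa using hx
      rw [Set.indicator_of_notMem h2, mul_zero]
      by_cases hx0 : 0 < x
      · rw [Set.indicator_of_mem (show x ∈ Set.Ioi 0 from hx0), Set.indicator_of_notMem, mul_zero]
        simpa [toPos_of_pos hx0] using hx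
      · rw [Set.indicator_of_notMem (by simpa using hx0)]
  · exact Measurable.indicator (((by fun_prop : Measurable fun x : ℝ =>
      ENNReal.ofReal (c * Real.exp (-(c * x)))).mul (hφ.comp measurable_toPos)))
        measurableSet_Ioi

/-! ### Poisson weights, the restart property and non-explosion -/

/-- The weights of the Poisson distribution with mean `c * t`. -/
def poissonWeight (c : Pos) (n : ℕ) (t : ℝ) : ℝ≥0∞ :=
  ENNReal.ofReal (Real.exp (-(c * t)) * (c * t) ^ n / n.factorial)

lemma poissonWeight_eq (c : Pos) (n : ℕ) (t : ℝ≥0) :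
    poissonWeight c n t = poissonMeasure (t * toNN c) {n} := by
  rw [poissonMeasure_singleton, poissonWeight]
  have : ((t * toNN c : ℝ≥0) : ℝ) = c * t := by
    rw [NNReal.coe_mul, mul_comm]
    rfl
  rw [this]

lemma measurable_poissonWeight (c : Pos) (n : ℕ) : Measurable (poissonWeight c n) := by
  unfold poissonWeight
  fun_prop

/-- Conditioning on the first arrival `x ≤ t` leaves `n` arrivals for the remaining time `t - x`.
The exponentials combine to `exp(-ct)`, and the integral of `(t - x)^n` supplies the factor
`t^(n+1)/(n+1)`. -/
lemma lintegral_poissonWeight (c : Pos) (n : ℕ) {t : ℝ} (ht : 0 ≤ t) :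
    ∫⁻ x, {x : Pos | (x : ℝ) ≤ t}.indicator (fun x => poissonWeight c n (t - x)) x ∂expPos c =
      poissonWeight c (n + 1) t := by
  have hc : 0 < (c : ℝ) := c.2
  have hms : MeasurableSet {x : Pos | (x : ℝ) ≤ t} :=
    measurableSet_le measurable_subtype_coe measurable_const
  have hm : Measurable ({x : Pos | (x : ℝ) ≤ t}.indicator fun x => poissonWeight c n (t - x)) :=
    ((measurable_poissonWeight c n).comp (measurable_subtype_coe.const_sub t)).indicator hms
  rw [lintegral_expPos c hm, ← lintegral_indicator measurableSet_Ioi]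
  have h1 : ∀ x : ℝ, (Set.Ioi (0 : ℝ)).indicator (fun x => ENNReal.ofReal
      (c * Real.exp (-(c * x))) * {x : Pos | (x : ℝ) ≤ t}.indicator
        (fun x => poissonWeight c n (t - x)) (toPos x)) x =
      (Set.Ioc 0 t).indicator (fun x => ENNReal.ofReal
        (Real.exp (-(c * t)) * c ^ (n + 1) / n.factorial * (t - x) ^ n)) x := by
    intro x
    by_cases hx : x ∈ Set.Ioc 0 t
    · rw [Set.indicator_of_mem hx, Set.indicator_of_mem (show x ∈ Set.Ioi 0 from hx.1),
        Set.indicator_of_mem (by simpa [toPos_of_pos hx.1] using hx.2), poissonWeight,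
        ← ENNReal.ofReal_mul (by positivity), toPos_of_pos hx.1]
      congr 1
      have : Real.exp (-(c * t)) = Real.exp (-(c * x)) * Real.exp (-(c * (t - x))) := by
        rw [← Real.exp_add]
        ring_nf
      rw [this, mul_pow]
      ring
    · rw [Set.indicator_of_notMem hx]
      by_cases hx0 : 0 < x
      · rw [Set.indicator_of_mem (show x ∈ Set.Ioi 0 from hx0), Set.indicator_of_notMem, mul_zero]
        intro h
        exact hx ⟨hx0, by simpa [toPos_of_pos hx0] using h⟩
      · rw [Set.indicator_of_notMem (by simpa using hx0)]
  rw [lintegral_congr h1, lintegral_indicator measurableSet_Ioc,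
    ← ofReal_integral_eq_lintegral_ofReal]
  · rw [integral_const_mul, ← intervalIntegral.integral_of_le ht,
      intervalIntegral.integral_comp_sub_left (fun x => x ^ n) t, integral_pow, poissonWeight]
    congr 1
    rw [Nat.factorial_succ]
    push_cast
    field_simp
    simp [mul_pow]
  · exact (Continuous.integrableOn_Icc (by fun_prop)).mono_set Set.Ioc_subset_Icc_self
  · refine (ae_restrict_iff' measurableSet_Ioc).mpr (Filter.Eventually.of_forall fun x hx => ?_)
    have : 0 ≤ t - x := sub_nonneg.mpr hx.2
    positivity

/-- The law of a sequence of independent exponential variables. -/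
abbrev expLaw (c : Pos) : Measure Path := Measure.infinitePi fun _ => expPos c

lemma measurable_indicator_shift {φ : Path → ℝ≥0∞} (hφ : Measurable φ) (n : ℕ) (t : ℝ) :
    Measurable ((atLevel n t).indicator fun w => φ (shift n t w)) :=
  (hφ.comp (measurable_shift n t)).indicator (measurableSet_atLevel n t)

/-- Under `expLaw c` the path restarts afresh at every time `t`, independently of its level. -/
lemma lintegral_shift (c : Pos) {φ : Path → ℝ≥0∞} (hφ : Measurable φ) (n : ℕ) :
    ∀ {t : ℝ}, 0 ≤ t →
    ∫⁻ w, (atLevel n t).indicator (fun w => φ (shift n t w)) w ∂expLaw c =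
      poissonWeight c n t * ∫⁻ w, φ w ∂expLaw c := by
  induction n with
  | zero =>
    intro t ht
    -- At level `0` the first interarrival time exceeds `t`, and its excess is again exponential by
    -- memorylessness.
    rw [lintegral_infinitePi_cons _ (measurable_indicator_shift hφ 0 t),
      lintegral_infinitePi_cons _ hφ]
    have hm : Measurable fun a : Pos => ∫⁻ w, φ (cons a w) ∂expLaw c :=
      (hφ.comp measurable_cons).lintegral_prod_right'
    rw [show poissonWeight c 0 t = ENNReal.ofReal (Real.exp (-(c * t))) by simp [poissonWeight],
      ← lintegral_expPos_memoryless c ht hm]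
    refine lintegral_congr fun a => ?_
    by_cases ha : t < a
    · rw [Set.indicator_of_mem (show a ∈ {x : Pos | t < x} from ha)]
      refine lintegral_congr fun w => ?_
      rw [Set.indicator_of_mem ((cons_mem_atLevel_zero ht).mpr ha), shift_zero_cons]
    · rw [Set.indicator_of_notMem (show a ∉ {x : Pos | t < x} from ha), ← lintegral_zero]
      refine lintegral_congr fun w => ?_
      rw [Set.indicator_of_notMem fun h => ha ((cons_mem_atLevel_zero ht).mp h)]
  | succ n ih =>
    intro t ht
    -- At level `n + 1` the first arrival `a` comes by time `t`; the rest of the path is at level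
    -- `n` at time `t - a`, and the weights convolve.
    rw [lintegral_infinitePi_cons _ (measurable_indicator_shift hφ _ t),
      ← lintegral_poissonWeight c n ht, ← lintegral_mul_const]
    · refine lintegral_congr fun a => ?_
      by_cases ha : (a : ℝ) ≤ t
      · rw [Set.indicator_of_mem (show a ∈ {x : Pos | (x : ℝ) ≤ t} from ha),
          ← ih (sub_nonneg.mpr ha)]
        refine lintegral_congr fun w => ?_
        by_cases hw : w ∈ atLevel n (t - a) <;> simp [cons_mem_atLevel_succ, shift_succ_cons, hw]
      · rw [Set.indicator_of_notMem (show a ∉ {x : Pos | (x : ℝ) ≤ t} from ha), zero_mul,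
          ← lintegral_zero]
        refine lintegral_congr fun w => ?_
        rw [Set.indicator_of_notMem]
        rw [cons_mem_atLevel_succ]
        exact notMem_atLevel_of_neg (by simpa using ha) w
    · exact ((measurable_poissonWeight c n).comp (measurable_subtype_coe.const_sub t)).indicator
        (measurableSet_le measurable_subtype_coe measurable_const)

lemma expLaw_atLevel_inter_shift (c : Pos) (n : ℕ) {t : ℝ} (ht : 0 ≤ t) {A : Set Path}
    (hA : MeasurableSet A) :
    expLaw c (atLevel n t ∩ shift n t ⁻¹' A) = poissonWeight c n t * expLaw c A := by
  have h := lintegral_shift c (measurable_one.indicator hA) n ht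
  rw [lintegral_indicator_one hA] at h
  rw [← h, ← lintegral_indicator_one
    ((measurableSet_atLevel n t).inter (measurable_shift n t hA))]
  refine lintegral_congr fun w => ?_
  by_cases h1 : w ∈ atLevel n t <;> by_cases h2 : shift n t w ∈ A <;> simp [h1, h2]

lemma expLaw_atLevel (c : Pos) (n : ℕ) {t : ℝ} (ht : 0 ≤ t) :
    expLaw c (atLevel n t) = poissonWeight c n t := by
  simpa using expLaw_atLevel_inter_shift c n ht MeasurableSet.univ

lemma pairwise_disjoint_atLevel (t : ℝ) : Pairwise (Function.onFun Disjoint fun n => atLevel n t) :=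
  fun _ _ hmn => Set.disjoint_left.mpr fun _ h1 h2 => hmn (atLevel_unique h1 h2)

lemma expLaw_iUnion_atLevel (c : Pos) (t : ℝ≥0) : expLaw c (⋃ n, atLevel n t) = 1 := by
  rw [measure_iUnion (pairwise_disjoint_atLevel t) fun n => measurableSet_atLevel n t]
  simp_rw [expLaw_atLevel c _ (NNReal.coe_nonneg t), poissonWeight_eq]
  have := measure_iUnion (μ := poissonMeasure (t * toNN c)) (f := fun n : ℕ => {n})
    (fun m n hmn => by simpa [Function.onFun] using hmn) (fun n => measurableSet_singleton n)
  rw [← this, Set.iUnion_of_singleton, measure_univ]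

/-- Since Poisson weights sum to one, almost every path is at some level at each integer time; a
path whose arrival times are bounded by `M` is at no level at time `M`. -/
lemma expLaw_explosive (c : Pos) : expLaw c explosive = 0 := by
  refine measure_mono_null (t := ⋃ M : ℕ, (⋃ n, atLevel n ((M : ℝ≥0) : ℝ))ᶜ) ?_ ?_
  · rintro w ⟨b, hb⟩
    obtain ⟨M, hM⟩ := exists_nat_ge b
    simp only [Set.mem_iUnion, Set.mem_compl_iff, not_exists]
    refine ⟨M, fun n hn => absurd hn.2 (not_lt.mpr ?_)⟩
    exact (hb ⟨n + 1, rfl⟩).trans (by simpa using hM)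
  · rw [measure_iUnion_null_iff]
    intro M
    rw [prob_compl_eq_zero_iff (MeasurableSet.iUnion fun n => measurableSet_atLevel n _)]
    exact expLaw_iUnion_atLevel c M

lemma ae_notMem_explosive (c : Pos) : ∀ᵐ w ∂expLaw c, w ∉ explosive := by
  rw [ae_iff]
  simpa using expLaw_explosive c

lemma map_count (c : Pos) (t : ℝ≥0) : (expLaw c).map (count t) = poissonMeasure (t * toNN c) := by
  refine Measure.ext_of_singleton fun n => ?_
  rw [Measure.map_apply (measurable_count t) (measurableSet_singleton n), ← poissonWeight_eq,
    ← expLaw_atLevel c n (NNReal.coe_nonneg t)]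
  refine measure_congr ?_
  filter_upwards [ae_notMem_explosive c] with w hw
  refine propext ⟨fun h => ?_, fun h => count_of_mem h⟩
  have := mem_atLevel_count hw t
  rwa [show count t w = n from h] at this

/-! ### Increments of the counting process of exponential interarrival times -/

/-- The increment of the counting function of a path. -/
def pathIncr (s t : ℝ≥0) (w : Path) : ℤ := (count t w : ℤ) - (count s w : ℤ)

lemma measurable_pathIncr (s t : ℝ≥0) : Measurable (pathIncr s t) :=
  (measurable_from_top.comp (measurable_count t)).sub
    (measurable_from_top.comp (measurable_count s))

/-- The Poisson distribution as a measure on the integers. -/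
abbrev poissonInt (r : ℝ≥0) : Measure ℤ := (poissonMeasure r).map (Nat.cast : ℕ → ℤ)

instance (r : ℝ≥0) : IsProbabilityMeasure (poissonInt r) :=
  Measure.isProbabilityMeasure_map (by fun_prop)

/-- Finite measures on sequences are determined by their values on boxes. -/
lemma ext_of_boxes {β : Type*} [MeasurableSpace β] {μ ν : Measure (ℕ → β)} [IsFiniteMeasure μ]
    (h : ∀ (m : ℕ) (B : ℕ → Set β), (∀ i, MeasurableSet (B i)) →
      μ {x | ∀ i < m, x i ∈ B i} = ν {x | ∀ i < m, x i ∈ B i}) : μ = ν := by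
  classical
  refine ext_of_generate_finite _ (generateFrom_squareCylinders (α := fun _ : ℕ => β)).symm
    (isPiSystem_squareCylinders (fun _ => MeasurableSpace.isPiSystem_measurableSet)
      fun _ => (MeasurableSet.univ : MeasurableSet (Set.univ : Set β))) ?_ ?_
  · rintro _ ⟨s, t, ht, rfl⟩
    have ht' : ∀ i, MeasurableSet (t i) := fun i => ht i trivial
    obtain ⟨m, hm⟩ : ∃ m, s ⊆ Finset.range (m + 1) :=
      ⟨s.sup id, fun i hi =>
        Finset.mem_range.mpr (Nat.lt_succ_of_le (Finset.le_sup (f := id) hi))⟩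
    have hbox : Set.pi s t =
        {x | ∀ i < m + 1, x i ∈ if i ∈ s then t i else Set.univ} := by
      ext x
      simp only [Set.mem_pi, Finset.mem_coe, Set.mem_ofPred_eq]
      constructor
      · intro h i _
        split_ifs with h0
        exacts [h i h0, trivial]
      · intro h i hi
        simpa [hi] using h i (Finset.mem_range.mp (hm hi))
    rw [hbox]
    refine h _ _ fun i => ?_
    split_ifs
    exacts [ht' i, MeasurableSet.univ]
  · simpa using h 0 (fun _ => Set.univ) fun _ => MeasurableSet.univ

lemma map_eq_infinitePi_of_boxes {α β : Type*} [MeasurableSpace α] [MeasurableSpace β]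
    {μ : Measure α} {ν : ℕ → Measure β} [∀ i, IsProbabilityMeasure (ν i)] {f : α → ℕ → β}
    (hf : Measurable f)
    (h : ∀ (m : ℕ) (B : ℕ → Set β), (∀ i, MeasurableSet (B i)) →
      μ {a | ∀ i < m, f a i ∈ B i} = ∏ i ∈ Finset.range m, ν i (B i)) :
    μ.map f = Measure.infinitePi ν := by
  symm
  refine ext_of_boxes fun m B hB => ?_
  have hbox : {x : ℕ → β | ∀ i < m, x i ∈ B i} = Set.pi (Finset.range m) B := by
    ext x
    simp
  have hmeas : MeasurableSet {x : ℕ → β | ∀ i < m, x i ∈ B i} := by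
    rw [hbox]
    exact MeasurableSet.pi (Finset.countable_toSet _) fun i _ => hB i
  rw [Measure.map_apply hf hmeas, hbox, Measure.infinitePi_pi _ fun i _ => hB i, ← h m B hB]
  congr 1
  ext a
  simp

/-- The times with given durations between them, beginning at `0`. -/
def partialTime (d : ℕ → ℝ≥0) (i : ℕ) : ℝ≥0 := ∑ j ∈ Finset.range i, d j

lemma partialTime_succ' (d : ℕ → ℝ≥0) (i : ℕ) :
    partialTime d (i + 1) = d 0 + partialTime (fun j => d (j + 1)) i := by
  rw [partialTime, Finset.sum_range_succ', add_comm, partialTime]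

/-- Induction on the number of increments: the first one is the level at time `d 0`, and the others
are the increments of the path shifted by `d 0`, whose law does not depend on that level. -/
lemma expLaw_increments (c : Pos) (m : ℕ) : ∀ (d : ℕ → ℝ≥0) (B : ℕ → Set ℤ),
    expLaw c {w | ∀ i < m, pathIncr (partialTime d i) (partialTime d (i + 1)) w ∈ B i} =
      ∏ i ∈ Finset.range m, poissonInt (d i * toNN c) (B i) := by
  classical
  induction m with
  | zero => simp
  | succ m ih =>
    intro d B
    set d' : ℕ → ℝ≥0 := fun j => d (j + 1) with hd'
    set B' : ℕ → Set ℤ := fun j => B (j + 1) with hB'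
    set E' : Set Path := {w | ∀ i < m, pathIncr (partialTime d' i) (partialTime d' (i + 1)) w ∈ B' i}
      with hE'
    have hmE' : MeasurableSet E' := by
      have : E' = ⋂ i, ⋂ _ : i < m, pathIncr (partialTime d' i) (partialTime d' (i + 1)) ⁻¹' B' i := by
        ext w
        simp [hE']
      rw [this]
      exact MeasurableSet.iInter fun i => MeasurableSet.iInter fun _ =>
        measurable_pathIncr _ _ (MeasurableSet.of_discrete)
    -- The event is split by the level `n` at time `d 0`; only values `n` allowed by `B 0`
    -- contribute.
    set A : ℕ → Set Path := fun n =>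
      if (n : ℤ) ∈ B 0 then atLevel n (d 0) ∩ shift n (d 0) ⁻¹' E' else ∅ with hA
    have hmA : ∀ n, MeasurableSet (A n) := fun n => by
      simp only [hA]
      split_ifs
      exacts [(measurableSet_atLevel _ _).inter (measurable_shift _ _ hmE'), MeasurableSet.empty]
    have hAsub : ∀ n, A n ⊆ atLevel n (d 0) := fun n => by
      simp only [hA]
      split_ifs
      exacts [Set.inter_subset_left, Set.empty_subset _]
    have hcongr : expLaw c {w | ∀ i < m + 1,
        pathIncr (partialTime d i) (partialTime d (i + 1)) w ∈ B i} = expLaw c (⋃ n, A n) := by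
      refine measure_congr ?_
      filter_upwards [ae_notMem_explosive c] with w hw
      have hlev := mem_atLevel_count hw (d 0)
      set n := count (d 0) w with hn
      have hA_iff : w ∈ ⋃ k, A k ↔ (n : ℤ) ∈ B 0 ∧ shift n (d 0) w ∈ E' := by
        rw [Set.mem_iUnion]
        constructor
        · rintro ⟨k, hk⟩
          obtain rfl : k = n := atLevel_unique (hAsub k hk) hlev
          simp only [hA] at hk
          split_ifs at hk with h0
          exacts [⟨h0, hk.2⟩, hk.elim]
        · rintro ⟨h0, h1⟩
          refine ⟨n, ?_⟩
          simp only [hA, h0, if_true]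
          exact ⟨hlev, h1⟩
      have h0 : pathIncr (partialTime d 0) (partialTime d (0 + 1)) w = n := by
        simp [pathIncr, partialTime, count_zero, hn]
      have h1 : ∀ i, pathIncr (partialTime d (i + 1)) (partialTime d (i + 1 + 1)) w =
          pathIncr (partialTime d' i) (partialTime d' (i + 1)) (shift n (d 0) w) := fun i => by
        simp only [pathIncr]
        rw [partialTime_succ' d i, partialTime_succ' d (i + 1), count_add hlev hw, count_add hlev hw]
        push_cast
        ring
      refine propext (Iff.trans ?_ hA_iff.symm)
      change (∀ i < m + 1, _) ↔ _
      constructor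
      · intro h
        refine ⟨h0 ▸ h 0 (Nat.succ_pos m), fun i hi => ?_⟩
        rw [← h1]
        exact h (i + 1) (by omega)
      · rintro ⟨h2, h3⟩ i hi
        cases i with
        | zero => rwa [h0]
        | succ i =>
          rw [h1]
          exact h3 i (by omega)
    have hdisj : Pairwise (Function.onFun Disjoint A) := fun i j hij =>
      (pairwise_disjoint_atLevel (d 0) hij).mono (hAsub i) (hAsub j)
    rw [hcongr, measure_iUnion hdisj hmA, Finset.prod_range_succ', mul_comm]
    have hval : ∀ n, expLaw c (A n) =
        ((Nat.cast : ℕ → ℤ) ⁻¹' B 0).indicator (fun n => poissonMeasure (d 0 * toNN c) {n}) n *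
          expLaw c E' := fun n => by
      by_cases h0 : (n : ℤ) ∈ B 0
      · rw [Set.indicator_of_mem (show n ∈ (Nat.cast : ℕ → ℤ) ⁻¹' B 0 from h0), ← poissonWeight_eq,
          ← expLaw_atLevel_inter_shift c n (NNReal.coe_nonneg _) hmE']
        simp [hA, h0]
      · rw [Set.indicator_of_notMem (show n ∉ (Nat.cast : ℕ → ℤ) ⁻¹' B 0 from h0)]
        simp [hA, h0]
    simp_rw [hval]
    rw [ENNReal.tsum_mul_right, Measure.tsum_indicator_apply_singleton _ _ MeasurableSet.of_discrete,
      hE', ih, poissonInt, Measure.map_apply (by fun_prop) MeasurableSet.of_discrete]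

lemma map_increments (c : Pos) (d : ℕ → ℝ≥0) :
    (expLaw c).map (fun w i => pathIncr (partialTime d i) (partialTime d (i + 1)) w) =
      Measure.infinitePi fun i => poissonInt (d i * toNN c) :=
  map_eq_infinitePi_of_boxes (measurable_pi_lambda _ fun _ => measurable_pathIncr _ _)
    fun m B _ => expLaw_increments c m d B

lemma map_pathIncr (c : Pos) {s t : ℝ≥0} (hst : s ≤ t) :
    (expLaw c).map (pathIncr s t) = poissonInt ((t - s) * toNN c) := by
  -- With durations `s, t - s, t - s, …` the interval of index `1` is `[s, t]`.
  have h := congrArg (Measure.map (fun x : ℕ → ℤ => x 1))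
    (map_increments c (cons s fun _ => t - s))
  rw [Measure.infinitePi_map_eval,
    Measure.map_map (measurable_pi_apply 1)
      (measurable_pi_lambda _ fun _ => measurable_pathIncr _ _)] at h
  simpa [Function.comp_def, partialTime, Finset.sum_range_succ, hst] using h

lemma hasIndepIncrements_count (c : Pos) :
    HasIndepIncrements (fun t w => (count t w : ℤ)) (expLaw c) := by
  refine HasIndepIncrements.of_nat fun t ht _ => ?_
  -- Partial times begin at `0`, so an interval `[0, t 0]` is prepended; the increments wanted are
  -- those with successor indices.
  set d : ℕ → ℝ≥0 := cons (t 0) fun i => t (i + 1) - t i with hd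
  have hτ : ∀ i, partialTime d (i + 1) = t i := fun i => by
    induction i with
    | zero => simp [partialTime, hd]
    | succ i ih =>
      rw [partialTime, Finset.sum_range_succ, ← partialTime, ih, hd, cons_succ]
      exact add_tsub_cancel_of_le (ht (Nat.le_succ i))
  have hind : iIndepFun (fun i w => pathIncr (partialTime d i) (partialTime d (i + 1)) w)
      (expLaw c) := by
    rw [iIndepFun_iff_map_fun_eq_infinitePi_map fun i => measurable_pathIncr _ _, map_increments]
    congr 1
    funext i
    have h := congrArg (Measure.map (fun x : ℕ → ℤ => x i)) (map_increments c d)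
    rw [Measure.infinitePi_map_eval,
      Measure.map_map (measurable_pi_apply i)
        (measurable_pi_lambda _ fun _ => measurable_pathIncr _ _)] at h
    exact h.symm
  have := hind.precomp (g := Nat.succ) Nat.succ_injective
  simpa [hτ, pathIncr, Nat.succ_eq_add_one] using this

/-! ### Changes of measure for finitely many coordinates -/

lemma lintegral_expPos_change (c c' : Pos) {φ : Pos → ℝ≥0∞} (hφ : Measurable φ) :
    ∫⁻ x, φ x ∂expPos c =
      ∫⁻ x, ENNReal.ofReal ((c / c') * Real.exp (-((c - c') * x))) * φ x ∂expPos c' := by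
  have hc : 0 < (c : ℝ) := c.2
  have hc' : 0 < (c' : ℝ) := c'.2
  rw [lintegral_expPos c hφ, lintegral_expPos c' (by fun_prop)]
  refine setLIntegral_congr_fun measurableSet_Ioi fun x hx => ?_
  rw [← mul_assoc, ← ENNReal.ofReal_mul (by positivity), toPos_of_pos hx]
  congr 2
  rw [show -((c : ℝ) * x) = -(c' * x) + -((c - c') * x) by ring, Real.exp_add]
  field_simp

/-- Each of the first `n` interarrival times contributes `(c/c') exp(-(c-c')W_k)`, and the survival
from `T_n` to `t` contributes `exp(-(c-c')(t-T_n))`. The exponents add up to `t`, so the ratio does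
not depend on the path. The interarrival time straddling `t` is observed only as exceeding `t`,
whence the restriction on `φ`. -/
lemma lintegral_atLevel_change (c c' : Pos) (n : ℕ) : ∀ {t : ℝ}, 0 ≤ t →
    ∀ {φ : Path → ℝ≥0∞}, Measurable φ → DependsOn φ (Set.Iio n) →
    ∫⁻ w, (atLevel n t).indicator φ w ∂expLaw c =
      ENNReal.ofReal ((c / c') ^ n * Real.exp (-((c - c') * t))) *
        ∫⁻ w, (atLevel n t).indicator φ w ∂expLaw c' := by
  have hc : 0 < (c : ℝ) := c.2
  have hc' : 0 < (c' : ℝ) := c'.2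
  induction n with
  | zero =>
    intro t ht φ hφ hdep
    have hconst : φ = fun _ => φ (fun _ => c) := funext fun w => hdep fun i hi => absurd hi (by simp)
    rw [hconst, lintegral_indicator (measurableSet_atLevel 0 t),
      lintegral_indicator (measurableSet_atLevel 0 t), setLIntegral_const, setLIntegral_const,
      expLaw_atLevel c 0 ht, expLaw_atLevel c' 0 ht, mul_left_comm]
    congr 1
    rw [poissonWeight, poissonWeight, ← ENNReal.ofReal_mul (by positivity)]
    congr 1
    simp only [pow_zero, one_mul, mul_one, Nat.factorial_zero, Nat.cast_one, div_one]
    rw [← Real.exp_add]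
    ring_nf
  | succ n ih =>
    intro t ht φ hφ hdep
    have hm : Measurable ((atLevel (n + 1) t).indicator φ) :=
      hφ.indicator (measurableSet_atLevel _ _)
    have hm' : ∀ b : Pos, Measurable fun a =>
        ∫⁻ w, (atLevel (n + 1) t).indicator φ (cons a w) ∂expLaw b := fun b =>
      (hm.comp measurable_cons).lintegral_prod_right'
    rw [lintegral_infinitePi_cons _ hm, lintegral_infinitePi_cons _ hm,
      lintegral_expPos_change c c' (hm' c), ← lintegral_const_mul _ (hm' c')]
    refine lintegral_congr fun a => ?_
    have hind : ∀ w, (atLevel (n + 1) t).indicator φ (cons a w) =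
        (atLevel n (t - a)).indicator (fun w => φ (cons a w)) w := fun w => by
      by_cases hw : w ∈ atLevel n (t - a) <;> simp [cons_mem_atLevel_succ, hw]
    simp only [hind]
    by_cases ha : (a : ℝ) ≤ t
    · rw [ih (sub_nonneg.mpr ha) (φ := fun w => φ (cons a w))
        (hφ.comp (measurable_cons.comp measurable_prodMk_left)), ← mul_assoc,
        ← ENNReal.ofReal_mul (by positivity)]
      · congr 2
        rw [show -(((c : ℝ) - c') * t) = -((c - c') * a) + -((c - c') * (t - a)) by ring,
          Real.exp_add]
        ring
      · intro w w' h
        refine hdep fun i hi => ?_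
        cases i with
        | zero => rfl
        | succ i => exact h i (by simpa using hi)
    · have h0 : ∀ w, (atLevel n (t - a)).indicator (fun w => φ (cons a w)) w = 0 := fun w =>
        Set.indicator_of_notMem (notMem_atLevel_of_neg (by linarith) w) _
      simp [h0]

/-- Infinite powers of two different laws are mutually singular, so a density exists only for
functions of finitely many coordinates. -/
lemma lintegral_infinitePi_change {α : Type*} [MeasurableSpace α] {μ ν : Measure α}
    [IsProbabilityMeasure μ] [IsProbabilityMeasure ν] {h : α → ℝ≥0∞} (hh : Measurable h)
    (hν : ν = μ.withDensity h) (n : ℕ) : ∀ {φ : (ℕ → α) → ℝ≥0∞}, Measurable φ →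
    DependsOn φ (Set.Iio n) →
    ∫⁻ x, φ x ∂(Measure.infinitePi fun _ : ℕ => ν) =
      ∫⁻ x, (∏ k ∈ Finset.range n, h (x k)) * φ x ∂(Measure.infinitePi fun _ : ℕ => μ) := by
  induction n with
  | zero =>
    intro φ hφ hdep
    obtain ⟨a⟩ : Nonempty α := nonempty_of_isProbabilityMeasure μ
    have hconst : φ = fun _ => φ (fun _ => a) := funext fun w => hdep fun i hi => absurd hi (by simp)
    rw [hconst]
    simp
  | succ n ih =>
    intro φ hφ hdep
    have hm : Measurable fun x : ℕ → α => (∏ k ∈ Finset.range (n + 1), h (x k)) * φ x := by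
      fun_prop
    have hm' : ∀ (m : ℕ), Measurable fun x : ℕ → α => ∏ k ∈ Finset.range m, h (x k) := by
      intro m
      fun_prop
    rw [lintegral_infinitePi_cons _ hφ, lintegral_infinitePi_cons _ hm]
    have hm1 : Measurable fun a => ∫⁻ w, φ (cons a w) ∂(Measure.infinitePi fun _ : ℕ => ν) :=
      (hφ.comp measurable_cons).lintegral_prod_right'
    conv_lhs => rw [hν]
    rw [lintegral_withDensity_eq_lintegral_mul _ hh (hν ▸ hm1)]
    refine lintegral_congr fun a => ?_
    have hφa : Measurable fun w => φ (cons a w) :=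
      hφ.comp (measurable_cons.comp measurable_prodMk_left)
    simp only [Pi.mul_apply]
    have hm2 : Measurable fun x : ℕ → α => (∏ k ∈ Finset.range n, h (x k)) * φ (cons a x) :=
      (hm' n).mul hφa
    rw [← hν, ih hφa, ← lintegral_const_mul _ hm2]
    · refine lintegral_congr fun w => ?_
      rw [Finset.prod_range_succ']
      simp only [cons_zero, cons_succ]
      ring
    · intro w w' h
      refine hdep fun i hi => ?_
      cases i with
      | zero => rfl
      | succ i => exact h i (by simpa using hi)

/-! ### Measurability on the canonical space -/

lemma measurable_N (t : ℝ≥0) : Measurable (N t) := (measurable_count t).comp measurable_fst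

lemma measurable_incr (s t : ℝ≥0) : Measurable (incr s t) :=
  (measurable_pathIncr s t).comp measurable_fst

lemma measurable_X (n : ℕ) : Measurable (X n) :=
  (measurable_pi_apply n).comp (measurable_fst.comp measurable_snd)

lemma measurable_W (n : ℕ) : Measurable (W n) := (measurable_pi_apply n).comp measurable_fst

lemma measurable_sum_range_N {f : ℕ → Ω → ℝ} (hf : ∀ k, Measurable (f k)) (t : ℝ≥0) :
    Measurable fun ω => ∑ k ∈ Finset.range (N t ω), f k ω := by
  have : Measurable fun p : ℕ × Ω => ∑ k ∈ Finset.range p.1, f k p.2 :=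
    measurable_from_prod_countable_right fun n =>
      Finset.measurable_fun_sum (Finset.range n) fun k _ => hf k
  exact this.comp ((measurable_N t).prodMk measurable_id)

lemma measurable_S (t : ℝ≥0) : Measurable (S t) :=
  measurable_sum_range_N (fun k => measurable_subtype_coe.comp (measurable_X k)) t

lemma F_le (t : ℝ≥0) : F t ≤ (inferInstance : MeasurableSpace Ω) :=
  sup_le (iSup₂_le fun u _ => (measurable_S u).comap_le) measurable_Θ.comap_le

lemma measurableSet_explosion : MeasurableSet explosion :=
  measurable_fst measurableSet_explosive

lemma F_mono {s t : ℝ≥0} (h : s ≤ t) : F s ≤ F t :=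
  sup_le (le_sup_of_le_left (iSup₂_le fun u hu =>
    le_iSup₂ (f := fun (u : ℝ≥0) (_ : u ≤ t) => MeasurableSpace.comap (S u) inferInstance)
      u (hu.trans h))) le_sup_right

namespace ClassF

variable {P : ProbabilityMeasure Ω}

lemma measurable_density (b : ClassF P) (t : ℝ≥0) (θ : Pos) : Measurable (b.density t θ) := by
  refine Real.measurable_exp.comp (Measurable.sub_const (measurable_sum_range_N
    (f := fun k ω => b.β (X k ω, θ)) (fun k => ?_) t) _)
  exact (b.measurable_γ.comp (measurable_X k)).const_add (b.α θ)

lemma measurable_density_Θ (b : ClassF P) (t : ℝ≥0) :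
    Measurable fun ω => b.density t (Θ ω) ω := by
  have hα : Measurable fun ω => b.α (Θ ω) := b.measurable_α.comp measurable_Θ
  have hΘ : Measurable fun ω => (Θ ω : ℝ) := measurable_subtype_coe.comp measurable_Θ
  refine Real.measurable_exp.comp ((measurable_sum_range_N
    (f := fun k ω => b.β (X k ω, Θ ω)) (fun k => ?_) t).sub ?_)
  · exact hα.add (b.measurable_γ.comp (measurable_X k))
  · fun_prop

lemma measurable_param (b : ClassF P) : Measurable b.param :=
  (measurable_subtype_coe.mul (Real.measurable_exp.comp b.measurable_α)).subtype_mk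

lemma density_zero (b : ClassF P) (θ : Pos) (ω : Ω) : b.density 0 θ ω = 1 := by
  simp [density, sumβ, N_eq, count_zero]

/-- Here `exp α(θ) = b.param θ / θ`, which brings the density into the form produced by
`lintegral_atLevel_change` and `lintegral_infinitePi_change`. -/
lemma density_of_mem (b : ClassF P) {t : ℝ≥0} {n : ℕ} (θ : Pos) {ω : Ω}
    (h : ω.1 ∈ atLevel n t) :
    ENNReal.ofReal (b.density t θ ω) =
      ENNReal.ofReal ((b.param θ / θ) ^ n * Real.exp (-((b.param θ - θ) * t))) *
        ∏ k ∈ Finset.range n, ENNReal.ofReal (Real.exp (b.γ (ω.2.1 k))) := by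
  have hθ : 0 < (θ : ℝ) := θ.2
  have hp : ((b.param θ : Pos) : ℝ) = θ * Real.exp (b.α θ) := rfl
  rw [← ENNReal.ofReal_prod_of_nonneg fun _ _ => (Real.exp_pos _).le, ← ENNReal.ofReal_mul
    (by rw [hp]; positivity), density, sumβ, N_eq, count_of_mem h, hp]
  congr 1
  rw [mul_div_cancel_left₀ _ hθ.ne', ← Real.exp_nat_mul, ← Real.exp_add, ← Real.exp_sum,
    ← Real.exp_add]
  simp only [β, Finset.sum_add_distrib, Finset.sum_const, Finset.card_range, nsmul_eq_mul]
  congr 1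
  simp only [X]
  ring

end ClassF

/-! ### Information up to time `t` on the event of `n` claims -/

/-- Replace all but the first `n` terms of a sequence by `1`. -/
def cut (n : ℕ) (w : ℕ → Pos) : ℕ → Pos :=
  fun k => if k < n then w k else ⟨1, Set.mem_Ioi.mpr one_pos⟩

lemma measurable_cut (n : ℕ) : Measurable (cut n) := by
  refine measurable_pi_lambda _ fun k => ?_
  by_cases h : k < n
  · simpa [cut, h] using measurable_pi_apply k
  · simp [cut, h]

lemma cut_of_lt {n k : ℕ} (h : k < n) (w : ℕ → Pos) : cut n w k = w k := if_pos h

lemma dependsOn_cut (n : ℕ) : DependsOn (cut n) (Set.Iio n) := by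
  intro w w' h
  funext k
  by_cases hk : k < n
  · simpa [cut, hk] using h k hk
  · simp [cut, hk]

lemma arrival_cut {n k : ℕ} (h : k ≤ n) (w : Path) : arrival k (cut n w) = arrival k w :=
  Finset.sum_congr rfl fun j hj => by
    rw [cut_of_lt ((Finset.mem_range.mp hj).trans_le h)]

/-- Keep the first `n` interarrival times, the first `n` claims and the structure parameter. -/
def trunc (n : ℕ) (ω : Ω) : Ω := (cut n ω.1, cut n ω.2.1, ω.2.2)

/-- The random number of summands is traded for a fixed one, so that `S u` becomes a function of the
first `n` interarrival times and claims. -/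
lemma S_eq_of_mem_atLevel {n : ℕ} {t u : ℝ≥0} (hu : u ≤ t) {ω : Ω} (h : ω.1 ∈ atLevel n t) :
    S u ω = ∑ k ∈ Finset.range n, if arrival (k + 1) ω.1 ≤ u then (X k ω : ℝ) else 0 := by
  have hut : (u : ℝ) ≤ t := NNReal.coe_le_coe.mpr hu
  obtain ⟨m, hm⟩ := exists_mem_atLevel_of_lt (NNReal.coe_nonneg u)
    ⟨n + 1, hut.trans_lt h.2⟩
  have hmn : m ≤ n := by
    by_contra! hlt
    have := arrival_mono ω.1 (show n + 1 ≤ m from hlt)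
    have h1 := hm.1
    have h2 := h.2
    linarith
  have hiff : ∀ k, arrival (k + 1) ω.1 ≤ u ↔ k < m := fun k => by
    constructor
    · intro hk
      by_contra! hlt
      have := arrival_mono ω.1 (show m + 1 ≤ k + 1 by omega)
      have h2 := hm.2
      linarith
    · intro hk
      exact (arrival_mono ω.1 hk).trans hm.1
  rw [S, N_eq, count_of_mem hm, ← Finset.sum_filter]
  refine Finset.sum_congr ?_ fun _ _ => rfl
  ext k
  simp only [Finset.mem_range, Finset.mem_filter, hiff]
  omega

/-- On level `n` each generator of `F t` is a measurable function of `trunc n`, hence the trace of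
`F t` there is contained in the σ-algebra pulled back along `trunc n`. -/
lemma exists_trunc_of_measurableSet_F {t : ℝ≥0} {A : Set Ω} (hA : MeasurableSet[F t] A) (n : ℕ) :
    ∃ B : Set Ω, MeasurableSet B ∧ ∀ ω : Ω, ω.1 ∈ atLevel n t → (ω ∈ A ↔ trunc n ω ∈ B) := by
  let D : Set Ω := {ω | ω.1 ∈ atLevel n t}
  have hle : (F t).comap (Subtype.val : D → Ω) ≤
      MeasurableSpace.comap (fun d : D => trunc n d.1) inferInstance := by
    have hcomp : ∀ {β : Type} [MeasurableSpace β] (f h : Ω → β), Measurable h →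
        (∀ ω ∈ D, f ω = h (trunc n ω)) →
        (MeasurableSpace.comap f inferInstance).comap (Subtype.val : D → Ω) ≤
          MeasurableSpace.comap (fun d : D => trunc n d.1) inferInstance := by
      intro β _ f h hh hfh
      rw [MeasurableSpace.comap_comp]
      have : f ∘ (Subtype.val : D → Ω) = h ∘ fun d : D => trunc n d.1 :=
        funext fun d => hfh d.1 d.2
      rw [this, ← MeasurableSpace.comap_comp]
      exact MeasurableSpace.comap_mono hh.comap_le
    rw [MeasurableSpace.comap_sup, MeasurableSpace.comap_iSup]
    refine sup_le (iSup_le fun u => ?_) (hcomp Θ Θ measurable_Θ fun ω _ => rfl)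
    rw [MeasurableSpace.comap_iSup]
    refine iSup_le fun hu => ?_
    refine hcomp (S u) (fun ω => ∑ k ∈ Finset.range n,
      if arrival (k + 1) ω.1 ≤ u then (X k ω : ℝ) else 0) ?_ fun ω hω => ?_
    · refine Finset.measurable_fun_sum _ fun k _ => Measurable.ite ?_
        (measurable_subtype_coe.comp (measurable_X k)) measurable_const
      exact measurableSet_le ((measurable_arrival _).comp measurable_fst) measurable_const
    · rw [S_eq_of_mem_atLevel hu hω]
      refine Finset.sum_congr rfl fun k hk => ?_
      have hk' := Finset.mem_range.mp hk
      simp only [trunc, X, arrival_cut (show k + 1 ≤ n from hk'), cut_of_lt hk']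
  obtain ⟨B, hB, hBA⟩ := hle (Subtype.val ⁻¹' A) ⟨A, hA, rfl⟩
  refine ⟨B, hB, fun ω hω => ?_⟩
  have := Set.ext_iff.mp hBA ⟨ω, hω⟩
  exact this.symm

/-! ### The fibre measures -/

/-- The law of the canonical process with exponential interarrival times of rate `c`, claim size
distribution `ν` and structure parameter `θ`. -/
def fib (c : Pos) (ν : Measure Pos) [IsProbabilityMeasure ν] (θ : Pos) : Measure Ω :=
  (expLaw c).prod ((Measure.infinitePi fun _ : ℕ => ν).prod (Measure.dirac θ))

section Fib

variable (c : Pos) (ν : Measure Pos) [IsProbabilityMeasure ν] (θ : Pos)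

instance : IsProbabilityMeasure (fib c ν θ) := by
  unfold fib
  infer_instance

lemma lintegral_fib {φ : Ω → ℝ≥0∞} (hφ : Measurable φ) :
    ∫⁻ ω, φ ω ∂fib c ν θ =
      ∫⁻ w, ∫⁻ x, φ (w, x, θ) ∂(Measure.infinitePi fun _ : ℕ => ν) ∂expLaw c := by
  rw [fib, lintegral_prod _ hφ.aemeasurable]
  refine lintegral_congr fun w => ?_
  have hw : Measurable fun p => φ (w, p) := hφ.comp measurable_prodMk_left
  rw [lintegral_prod _ hw.aemeasurable]
  refine lintegral_congr fun x => ?_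
  exact lintegral_dirac' θ (hw.comp measurable_prodMk_left)

lemma map_fst_fib : (fib c ν θ).map Prod.fst = expLaw c := by
  rw [fib, Measure.map_fst_prod, measure_univ, one_smul]

lemma map_snd_fib :
    (fib c ν θ).map Prod.snd = (Measure.infinitePi fun _ : ℕ => ν).prod (Measure.dirac θ) := by
  rw [fib, Measure.map_snd_prod, measure_univ, one_smul]

lemma map_claims_fib : (fib c ν θ).map (fun ω n => X n ω) = Measure.infinitePi fun _ : ℕ => ν := by
  have : (fun (ω : Ω) n => X n ω) = Prod.fst ∘ Prod.snd := rfl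
  rw [this, ← Measure.map_map measurable_fst measurable_snd, map_snd_fib, Measure.map_fst_prod,
    measure_univ, one_smul]

lemma map_X_fib (n : ℕ) : (fib c ν θ).map (X n) = ν := by
  have : X n = (fun x : ℕ → Pos => x n) ∘ fun (ω : Ω) n => X n ω := rfl
  rw [this, ← Measure.map_map (measurable_pi_apply n)
    (measurable_pi_lambda _ fun n => measurable_X n), map_claims_fib, Measure.infinitePi_map_eval]

lemma map_Θ_fib : (fib c ν θ).map Θ = Measure.dirac θ := by
  have : Θ = Prod.snd ∘ (Prod.snd : Ω → _) := rfl
  rw [this, ← Measure.map_map measurable_snd measurable_snd, map_snd_fib, Measure.map_snd_prod,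
    measure_univ, one_smul]

lemma indepFun_fib : IndepFun (Prod.fst : Ω → Path) (Prod.snd : Ω → _) (fib c ν θ) := by
  rw [indepFun_iff_map_prod_eq_prod_map_map measurable_fst.aemeasurable
    measurable_snd.aemeasurable, map_fst_fib, map_snd_fib]
  exact Measure.map_id

lemma fib_explosion : fib c ν θ explosion = 0 := by
  rw [explosion_eq, ← Measure.map_apply measurable_fst measurableSet_explosive, map_fst_fib,
    expLaw_explosive]

lemma isRiskProcess_fib : IsRiskProcess (fib c ν θ) where
  explosion_null := fib_explosion c ν θ
  indep_sizes := by
    rw [iIndepFun_iff_map_fun_eq_infinitePi_map measurable_X, map_claims_fib]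
    simp_rw [map_X_fib]
  ident_sizes n := ⟨(measurable_X n).aemeasurable, (measurable_X 0).aemeasurable, by
    rw [map_X_fib, map_X_fib]⟩
  indep := (indepFun_fib c ν θ).comp (φ := fun w t => count t w)
    (ψ := fun p : (ℕ → Pos) × Pos => p.1) (measurable_pi_lambda _ measurable_count) measurable_fst

lemma hasIndepIncrements_fib : HasIndepIncrements (fun t ω => (N t ω : ℤ)) (fib c ν θ) := by
  intro n t ht
  have h := hasIndepIncrements_count c n t ht
  rw [← map_fst_fib c ν θ] at h
  rw [iIndepFun_iff_measure_inter_preimage_eq_mul] at h ⊢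
  intro s B hB
  have hm : ∀ i : Fin n, MeasurableSet (pathIncr (t i.castSucc) (t i.succ) ⁻¹' B i) := fun i =>
    measurable_pathIncr _ _ MeasurableSet.of_discrete
  have key : (fib c ν θ).map Prod.fst (⋂ i ∈ s, pathIncr (t i.castSucc) (t i.succ) ⁻¹' B i) =
      ∏ i ∈ s, (fib c ν θ).map Prod.fst (pathIncr (t i.castSucc) (t i.succ) ⁻¹' B i) := h s hB
  rw [Measure.map_apply measurable_fst (Finset.measurableSet_biInter _ fun i _ => hm i),
    Finset.prod_congr rfl fun i _ => Measure.map_apply measurable_fst (hm i),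
    Set.preimage_iInter₂] at key
  exact key

lemma map_incr_fib {s t : ℝ≥0} (hst : s ≤ t) :
    (fib c ν θ).map (incr s t) = poissonInt ((t - s) * toNN c) := by
  have : incr s t = pathIncr s t ∘ (Prod.fst : Ω → Path) := rfl
  rw [this, ← Measure.map_map (measurable_pathIncr s t) measurable_fst, map_fst_fib,
    map_pathIncr c hst]

lemma map_N_fib (t : ℝ≥0) : (fib c ν θ).map (N t) = poissonMeasure (t * toNN c) := by
  have : N t = count t ∘ (Prod.fst : Ω → Path) := rfl
  rw [this, ← Measure.map_map (measurable_count t) measurable_fst, map_fst_fib, map_count]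

lemma isCPP_fib : IsCPP (fib c ν θ) c :=
  ⟨isRiskProcess_fib c ν θ, hasIndepIncrements_fib c ν θ, fun s t h hst => by
    rw [map_incr_fib c ν θ (add_le_add_left hst h), map_incr_fib c ν θ hst,
      add_tsub_add_eq_tsub_right], fun t _ => map_N_fib c ν θ t⟩

end Fib

/-- The density of the fibre measures on the information up to time `t`. -/
lemma fib_apply_of_measurableSet_F {P : ProbabilityMeasure Ω} (b : ClassF P) {μ ν : Measure Pos}
    [IsProbabilityMeasure μ] [IsProbabilityMeasure ν]
    (hν : ν = μ.withDensity fun x => ENNReal.ofReal (Real.exp (b.γ x))) (θ : Pos) {t : ℝ≥0}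
    {A : Set Ω} (hA : MeasurableSet[F t] A) :
    fib (b.param θ) ν θ A = ∫⁻ ω in A, ENNReal.ofReal (b.density t θ ω) ∂fib θ μ θ := by
  have hmA : MeasurableSet A := F_le t A hA
  set D : ℕ → Set Ω := fun n => Prod.fst ⁻¹' atLevel n t with hD
  have hmD : ∀ n, MeasurableSet (D n) := fun n => measurable_fst (measurableSet_atLevel n t)
  have hdisj : Pairwise (Function.onFun Disjoint fun n => A ∩ D n) := fun i j hij =>
    ((pairwise_disjoint_atLevel t hij).preimage _).mono Set.inter_subset_right
      Set.inter_subset_right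
  have hcover : ∀ (c : Pos) (ν : Measure Pos) [IsProbabilityMeasure ν],
      (⋃ n, A ∩ D n) =ᵐ[fib c ν θ] A := by
    intro c ν _
    have : ∀ᵐ ω ∂fib c ν θ, ω ∉ explosion := by
      rw [ae_iff]
      simpa using fib_explosion c ν θ
    filter_upwards [this] with ω hω
    refine propext ⟨fun h => ?_, fun h => ?_⟩
    · obtain ⟨n, hn⟩ := Set.mem_iUnion.mp h
      exact hn.1
    · exact Set.mem_iUnion.mpr ⟨count t ω.1, h, mem_atLevel_count hω t⟩
  rw [← measure_congr (hcover _ ν), measure_iUnion hdisj fun n => hmA.inter (hmD n),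
    ← setLIntegral_congr (hcover θ μ), lintegral_iUnion (fun n => hmA.inter (hmD n)) hdisj]
  refine tsum_congr fun n => ?_
  obtain ⟨B, hB, hAB⟩ := exists_trunc_of_measurableSet_F hA n
  set h : Pos → ℝ≥0∞ := fun x => ENNReal.ofReal (Real.exp (b.γ x)) with hh
  have hmh : Measurable h :=
    ENNReal.measurable_ofReal.comp (Real.measurable_exp.comp b.measurable_γ)
  -- On level `n`, `ψ` is the indicator of `A`; it sees only the first `n` terms of either sequence,
  -- as both change-of-measure lemmas require.
  set ψ : Path → (ℕ → Pos) → ℝ≥0∞ := fun w x => B.indicator 1 (cut n w, cut n x, θ) with hψ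
  have hmψ : Measurable fun p : Path × (ℕ → Pos) => ψ p.1 p.2 :=
    (measurable_one.indicator hB).comp (((measurable_cut n).comp measurable_fst).prodMk
      (((measurable_cut n).comp measurable_snd).prodMk measurable_const))
  have hprod : Measurable fun x : ℕ → Pos => ∏ k ∈ Finset.range n, h (x k) :=
    Finset.measurable_fun_prod _ fun k _ => hmh.comp (measurable_pi_apply k)
  set Φ : Path → ℝ≥0∞ := fun w => ∫⁻ x, (∏ k ∈ Finset.range n, h (x k)) * ψ w x
    ∂(Measure.infinitePi fun _ : ℕ => μ) with hΦ
  have hmΦ : Measurable Φ :=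
    ((hprod.comp measurable_snd).mul hmψ).lintegral_prod_right'
  have hdepΦ : DependsOn Φ (Set.Iio n) := fun w w' hww' => by
    simp only [hΦ, hψ, dependsOn_cut n hww']
  have hind : ∀ w x, (A ∩ D n).indicator (1 : Ω → ℝ≥0∞) (w, x, θ) =
      (atLevel n t).indicator (fun w => ψ w x) w := fun w x => by
    by_cases hw : w ∈ atLevel n t
    · have := hAB (w, x, θ) hw
      by_cases h2 : (w, x, θ) ∈ A
      · have h3 : (cut n w, cut n x, θ) ∈ B := this.mp h2
        simp [hD, hw, h2, hψ, h3]
      · have h3 : (cut n w, cut n x, θ) ∉ B := fun h3 => h2 (this.mpr h3)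
        simp [hD, hw, h2, hψ, h3]
    · simp [hD, hw]
  have hmd : Measurable ((A ∩ D n).indicator fun ω => ENNReal.ofReal (b.density t θ ω)) :=
    (ENNReal.measurable_ofReal.comp (b.measurable_density t θ)).indicator (hmA.inter (hmD n))
  rw [← lintegral_indicator_one (hmA.inter (hmD n)), lintegral_fib _ _ _
    (measurable_one.indicator (hmA.inter (hmD n))), ← lintegral_indicator (hmA.inter (hmD n)),
    lintegral_fib _ _ _ hmd]
  -- The claim law is changed first, with the path held fixed; the rate is changed afterwards for
  -- the function `Φ` of the path alone.
  have hL : ∀ w, ∫⁻ x, (A ∩ D n).indicator (1 : Ω → ℝ≥0∞) (w, x, θ)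
      ∂(Measure.infinitePi fun _ : ℕ => ν) = (atLevel n t).indicator Φ w := fun w => by
    simp only [hind]
    by_cases hw : w ∈ atLevel n t
    · simp only [Set.indicator_of_mem hw]
      refine lintegral_infinitePi_change hmh hν n (hmψ.comp measurable_prodMk_left) ?_
      intro x x' hxx'
      simp only [hψ, dependsOn_cut n hxx']
    · simp [Set.indicator_of_notMem hw]
  rw [lintegral_congr hL, lintegral_atLevel_change (b.param θ) θ n (NNReal.coe_nonneg t) hmΦ hdepΦ,
    ← lintegral_const_mul _ (hmΦ.indicator (measurableSet_atLevel n t))]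
  refine lintegral_congr fun w => ?_
  by_cases hw : w ∈ atLevel n t
  · have hmw : Measurable fun x => (∏ k ∈ Finset.range n, h (x k)) * ψ w x :=
      hprod.mul (hmψ.comp measurable_prodMk_left)
    simp only [Set.indicator_of_mem hw, hΦ]
    rw [← lintegral_const_mul _ hmw]
    refine lintegral_congr fun x => ?_
    have h1 := hind w x
    rw [Set.indicator_of_mem hw] at h1
    rw [← h1]
    by_cases h2 : (w, x, θ) ∈ A ∩ D n
    · rw [Set.indicator_of_mem h2, Set.indicator_of_mem h2,
        b.density_of_mem θ (ω := (w, x, θ)) hw]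
      simp [hh]
    · simp [Set.indicator_of_notMem h2]
  · rw [Set.indicator_of_notMem hw, mul_zero, ← lintegral_zero]
    refine lintegral_congr fun x => ?_
    rw [Set.indicator_of_notMem]
    exact fun h2 => hw h2.2

/-! ### Regular conditional probabilities over the structure parameter -/

section RCP

variable {Q : Measure Ω} {κ : Kernel Pos Ω}

/-- Consistency for `B` and for `Bᶜ` makes the fibre measure of `Θ ⁻¹' B` equal to one or zero
according to whether `θ ∈ B`, which localises the disintegration. -/
lemma IsRCP.setLIntegral (h : IsRCP κ Q) {D : Set Ω} (hD : MeasurableSet D) {B : Set Pos}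
    (hB : MeasurableSet B) : ∫⁻ θ in B, κ θ D ∂(Q.map Θ) = Q (Θ ⁻¹' B ∩ D) := by
  have hmΘB : MeasurableSet (Θ ⁻¹' B) := measurable_Θ hB
  rw [← h.disint _ (hmΘB.inter hD), ← lintegral_indicator hB]
  refine lintegral_congr_ae ?_
  filter_upwards [h.consistent B hB, h.consistent Bᶜ hB.compl] with θ h1 h2
  have := h.prob θ
  by_cases hθ : θ ∈ B
  · rw [Set.indicator_of_mem hθ]
    refine measure_congr ?_
    filter_upwards [(prob_compl_eq_zero_iff hmΘB).mpr (h1 hθ)] with ω hω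
    refine propext ⟨fun hd => ⟨by simpa using hω, hd⟩, fun hd => hd.2⟩
  · rw [Set.indicator_of_notMem hθ]
    refine (measure_mono_null Set.inter_subset_left ?_).symm
    have h3 := h2 hθ
    rw [Set.preimage_compl] at h3
    exact (prob_compl_eq_one_iff hmΘB).mp h3

variable [IsProbabilityMeasure Q]

/-- Uniqueness of disintegrations on a standard Borel space. Through it, conditional distributions
and conditional probabilities given `Θ` can be computed from any r.c.p. -/
lemma IsRCP.condDistrib_id (h : IsRCP κ Q) : condDistrib id Θ Q =ᵐ[Q.map Θ] κ := by
  have : IsMarkovKernel κ := ⟨h.prob⟩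
  have : IsProbabilityMeasure (Q.map Θ) := Measure.isProbabilityMeasure_map measurable_Θ.aemeasurable
  refine condDistrib_ae_eq_of_measure_eq_compProd Θ aemeasurable_id ?_
  have : IsProbabilityMeasure (Q.map fun ω => (Θ ω, id ω)) :=
    Measure.isProbabilityMeasure_map (measurable_Θ.prodMk measurable_id).aemeasurable
  refine Measure.ext_prod fun {B D} hB hD => ?_
  rw [Measure.map_apply (measurable_Θ.prodMk measurable_id) (hB.prod hD),
    Measure.compProd_apply_prod hB hD, h.setLIntegral hD hB]
  rfl

lemma IsRCP.unique {κ' : Kernel Pos Ω} (h : IsRCP κ Q) (h' : IsRCP κ' Q) :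
    ∀ᵐ θ ∂(Q.map Θ), κ θ = κ' θ := by
  filter_upwards [h.condDistrib_id, h'.condDistrib_id] with θ h1 h2
  rw [← h1, h2]

lemma IsRCP.condDistrib_eq (h : IsRCP κ Q) {β : Type*} [MeasurableSpace β] [StandardBorelSpace β]
    [Nonempty β] {Y : Ω → β} (hY : Measurable Y) :
    ∀ᵐ θ ∂(Q.map Θ), condDistrib Y Θ Q θ = (κ θ).map Y := by
  filter_upwards [h.condDistrib_id, condDistrib_comp Θ (μ := Q) aemeasurable_id hY] with θ h1 h2
  rw [← h1, ← Kernel.map_apply _ hY]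
  exact h2

lemma IsRCP.condExp_eq (h : IsRCP κ Q) {A : Set Ω} (hA : MeasurableSet A) :
    Q⟦A | sigmaΘ⟧ =ᵐ[Q] fun ω => (κ (Θ ω)).real A := by
  have h1 := condDistrib_ae_eq_condExp (μ := Q) measurable_Θ measurable_id hA
  filter_upwards [h1, ae_of_ae_map measurable_Θ.aemeasurable h.condDistrib_id] with ω h2 h3
  rw [← h3]
  exact h2.symm

end RCP

/-! ### The fibre measures form a kernel -/

lemma measurable_expPos_apply {A : Set Pos} (hA : MeasurableSet A) :
    Measurable fun c => expPos c A := by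
  have hA1 : Measurable (A.indicator (1 : Pos → ℝ≥0∞)) := measurable_one.indicator hA
  simp_rw [← lintegral_indicator_one hA, lintegral_expPos _ hA1]
  refine Measurable.lintegral_prod_right' (f := fun p : Pos × ℝ =>
    ENNReal.ofReal (p.1 * Real.exp (-(p.1 * p.2))) * A.indicator 1 (toPos p.2)) ?_
  exact Measurable.mul (by fun_prop) (hA1.comp (measurable_toPos.comp measurable_snd))

lemma measurable_expLaw : Measurable expLaw := by
  refine Measurable.measure_of_isPiSystem_of_isProbabilityMeasure
    (generateFrom_squareCylinders (α := fun _ : ℕ => Pos)).symm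
    (isPiSystem_squareCylinders (fun _ => MeasurableSpace.isPiSystem_measurableSet)
      fun _ => (MeasurableSet.univ : MeasurableSet (Set.univ : Set Pos))) ?_
  rintro _ ⟨s, t, ht, rfl⟩
  have ht' : ∀ i, MeasurableSet (t i) := fun i => ht i trivial
  simp_rw [expLaw, Measure.infinitePi_pi _ fun i _ => ht' i]
  exact Finset.measurable_fun_prod _ fun i _ => measurable_expPos_apply (ht' i)

/-- The kernel `c ↦ expLaw c`. -/
def expKernel : Kernel Pos Path := ⟨expLaw, measurable_expLaw⟩

instance : IsMarkovKernel expKernel := ⟨fun c => inferInstanceAs (IsProbabilityMeasure (expLaw c))⟩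

section Mixture

variable {g : Pos → Pos} (hg : Measurable g) (ν : Measure Pos) [IsProbabilityMeasure ν]

/-- The kernel `θ ↦ fib (g θ) ν θ`. -/
def fibKernel : Kernel Pos Ω :=
  (expKernel.comap g hg) ×ₖ
    ((Kernel.const Pos (Measure.infinitePi fun _ : ℕ => ν)) ×ₖ Kernel.id)

lemma fibKernel_apply (θ : Pos) : fibKernel hg ν θ = fib (g θ) ν θ := by
  rw [fibKernel, Kernel.prod_apply, Kernel.prod_apply, Kernel.comap_apply, Kernel.const_apply,
    Kernel.id_apply]
  rfl

instance : IsMarkovKernel (fibKernel hg ν) := by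
  unfold fibKernel
  infer_instance

variable (π : Measure Pos)

/-- The law of the canonical process when the structure parameter has law `π` and, conditionally on
it, the interarrival times are exponential of rate `g θ`. -/
abbrev mixture : Measure Ω := fibKernel hg ν ∘ₘ π

lemma mixture_apply {A : Set Ω} (hA : MeasurableSet A) :
    mixture hg ν π A = ∫⁻ θ, fib (g θ) ν θ A ∂π := by
  rw [mixture, Measure.bind_apply hA (Kernel.aemeasurable _)]
  simp_rw [fibKernel_apply]

lemma map_Θ_mixture : (mixture hg ν π).map Θ = π := by
  ext A hA
  rw [Measure.map_apply measurable_Θ hA, mixture_apply hg ν π (measurable_Θ hA)]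
  simp_rw [← Measure.map_apply measurable_Θ hA, map_Θ_fib, Measure.dirac_apply' _ hA]
  exact lintegral_indicator_one hA

lemma isRCP_fibKernel : IsRCP (fibKernel hg ν) (mixture hg ν π) where
  prob θ := inferInstance
  disint D hD := by
    rw [map_Θ_mixture, mixture, Measure.bind_apply hD (Kernel.aemeasurable _)]
  consistent B hB := Filter.Eventually.of_forall fun θ hθ => by
    rw [fibKernel_apply, ← Measure.map_apply measurable_Θ hB, map_Θ_fib, Measure.dirac_apply' _ hB]
    simp [hθ]

variable [IsProbabilityMeasure π]

lemma map_mixture_of_forall {β : Type*} [MeasurableSpace β] {f : Ω → β} (hf : Measurable f)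
    {ρ : Measure β} (h : ∀ θ, (fib (g θ) ν θ).map f = ρ) : (mixture hg ν π).map f = ρ := by
  ext A hA
  rw [Measure.map_apply hf hA, mixture_apply hg ν π (hf hA)]
  simp_rw [← Measure.map_apply hf hA, h]
  simp

/-- Conditional probabilities given `Θ` are those of the fibres, where paths and claims are
independent by construction. -/
lemma condA1_mixture : CondA1 (mixture hg ν π) := by
  have hW : Measurable fun (ω : Ω) n => W n ω := measurable_pi_lambda _ measurable_W
  have hX : Measurable fun (ω : Ω) n => X n ω := measurable_pi_lambda _ measurable_X
  rw [CondA1, condIndepFun_iff_condExp_inter_preimage_eq_mul hW hX]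
  intro s t hs ht
  have h := isRCP_fibKernel hg ν π
  filter_upwards [h.condExp_eq ((hW hs).inter (hX ht)), h.condExp_eq (hW hs),
    h.condExp_eq (hX ht)] with ω h1 h2 h3
  rw [h1, h2, h3, fibKernel_apply]
  have hind := (indepFun_fib (g (Θ ω)) ν (Θ ω)).measure_inter_preimage_eq_mul s
    (Prod.fst ⁻¹' t) hs (measurable_fst ht)
  simp only [measureReal_def, ← ENNReal.toReal_mul]
  exact congrArg ENNReal.toReal hind

/-- Independence need not survive mixing. It does here because the claims have the same law in every
fibre, so their factor leaves the integral. -/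
lemma indepFun_mixture_claims {β : Type*} [MeasurableSpace β] {f : Ω → β} (hf : Measurable f)
    (h : ∀ θ, IndepFun f (fun ω n => X n ω) (fib (g θ) ν θ)) :
    IndepFun f (fun ω n => X n ω) (mixture hg ν π) := by
  have hX : Measurable fun (ω : Ω) n => X n ω := measurable_pi_lambda _ measurable_X
  rw [indepFun_iff_measure_inter_preimage_eq_mul]
  intro s t hs ht
  rw [mixture_apply hg ν π ((hf hs).inter (hX ht)), mixture_apply hg ν π (hf hs),
    ← Measure.map_apply hX ht, map_mixture_of_forall hg ν π hX (fun θ => map_claims_fib _ ν θ),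
    ← lintegral_mul_const']
  · refine lintegral_congr fun θ => ?_
    rw [(h θ).measure_inter_preimage_eq_mul s t hs ht, ← Measure.map_apply hX ht, map_claims_fib]
  · exact measure_ne_top _ _

lemma condA2_mixture : CondA2 (mixture hg ν π) := by
  refine indepFun_mixture_claims hg ν π measurable_Θ fun θ => ?_
  have hind : IndepFun (Prod.fst : (ℕ → Pos) × Pos → _) Prod.snd
      ((Measure.infinitePi fun _ : ℕ => ν).prod (Measure.dirac θ)) := by
    rw [indepFun_iff_map_prod_eq_prod_map_map measurable_fst.aemeasurable
      measurable_snd.aemeasurable, Measure.map_fst_prod, Measure.map_snd_prod, measure_univ,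
      measure_univ, one_smul, one_smul]
    exact Measure.map_id
  rw [← map_snd_fib (g θ) ν θ] at hind
  rw [indepFun_iff_measure_inter_preimage_eq_mul] at hind ⊢
  intro s t hs ht
  have := hind t s ht hs
  rw [Measure.map_apply measurable_snd ((measurable_fst ht).inter (measurable_snd hs)),
    Measure.map_apply measurable_snd (measurable_fst ht),
    Measure.map_apply measurable_snd (measurable_snd hs), mul_comm] at this
  rw [Set.preimage_inter, Set.inter_comm] at this
  exact this

lemma isRiskProcess_mixture : IsRiskProcess (mixture hg ν π) where
  explosion_null := by
    rw [mixture_apply hg ν π measurableSet_explosion]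
    simp [fib_explosion]
  indep_sizes := by
    rw [iIndepFun_iff_map_fun_eq_infinitePi_map measurable_X,
      map_mixture_of_forall hg ν π (measurable_pi_lambda _ measurable_X)
        fun θ => map_claims_fib _ ν θ]
    congr 1
    funext n
    rw [map_mixture_of_forall hg ν π (measurable_X n) fun θ => map_X_fib _ ν θ n]
  ident_sizes n := ⟨(measurable_X n).aemeasurable, (measurable_X 0).aemeasurable, by
    rw [map_mixture_of_forall hg ν π (measurable_X n) fun θ => map_X_fib _ ν θ n,
      map_mixture_of_forall hg ν π (measurable_X 0) fun θ => map_X_fib _ ν θ 0]⟩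
  indep := indepFun_mixture_claims hg ν π (measurable_pi_lambda _ measurable_N)
    fun θ => (isRiskProcess_fib (g θ) ν θ).indep

lemma isMPP_mixture : IsMPP (mixture hg ν π) g where
  cond_indep m t ht := by
    have h := isRCP_fibKernel hg ν π
    rw [iCondIndepFun_iff_condExp_inter_preimage_eq_mul _ _ fun i => measurable_incr _ _]
    intro S B hB
    have hm : ∀ i : Fin m, MeasurableSet (incr (t i.castSucc) (t i.succ) ⁻¹' B i) := fun i =>
      measurable_incr _ _ MeasurableSet.of_discrete
    have h2 : ∀ᵐ ω ∂(mixture hg ν π), ∀ i : Fin m,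
        ((mixture hg ν π)⟦incr (t i.castSucc) (t i.succ) ⁻¹' B i | sigmaΘ⟧) ω =
          (fibKernel hg ν (Θ ω)).real (incr (t i.castSucc) (t i.succ) ⁻¹' B i) :=
      ae_all_iff.mpr fun i => h.condExp_eq (hm i)
    filter_upwards [h.condExp_eq (Finset.measurableSet_biInter S fun i _ => hm i), h2] with ω h3 h4
    rw [h3, Finset.prod_apply, Finset.prod_congr rfl fun i _ => h4 i, fibKernel_apply]
    have hind := iIndepFun_iff_measure_inter_preimage_eq_mul.mp
      (hasIndepIncrements_fib (g (Θ ω)) ν (Θ ω) m t ht) S hB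
    simp only [measureReal_def, ← ENNReal.toReal_prod]
    exact congrArg ENNReal.toReal hind
  cond_stat s t h hst := by
    have hR := isRCP_fibKernel hg ν π
    filter_upwards [hR.condDistrib_eq (measurable_incr (s + h) (t + h)),
      hR.condDistrib_eq (measurable_incr s t)] with θ h1 h2
    rw [h1, h2, fibKernel_apply, map_incr_fib _ ν θ hst, map_incr_fib _ ν θ (by gcongr),
      add_tsub_add_eq_tsub_right]
  cond_poisson t _ := by
    filter_upwards [(isRCP_fibKernel hg ν π).condDistrib_eq (measurable_N t)] with θ h1
    rw [h1, fibKernel_apply, map_N_fib]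

end Mixture

/-! ### Identification of the law from the defining properties of a mixed Poisson process -/

lemma setIntegral_condExp_preimage_Θ {Q : Measure Ω} [IsFiniteMeasure Q] {A : Set Ω}
    (hA : MeasurableSet A) {C : Set Pos} (hC : MeasurableSet C) :
    ∫ ω in Θ ⁻¹' C, (Q⟦A | sigmaΘ⟧) ω ∂Q = Q.real (Θ ⁻¹' C ∩ A) := by
  rw [setIntegral_condExp sigmaΘ_le ((integrable_const _).indicator hA) ⟨C, hC, rfl⟩,
    setIntegral_indicator hA]
  simp

/-- Conditional stationarity moves the interval to `[0, d]`, where the increment is `N d`. -/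
lemma IsMPP.condDistrib_incr {Q : Measure Ω} [IsProbabilityMeasure Q] {g : Pos → Pos}
    (h : IsMPP Q g) (s : ℝ≥0) {d : ℝ≥0} (hd : 0 < d) :
    ∀ᵐ θ ∂(Q.map Θ), condDistrib (incr s (s + d)) Θ Q θ = poissonInt (d * toNN (g θ)) := by
  have h0 : incr 0 d = (Nat.cast : ℕ → ℤ) ∘ N d := by
    funext ω
    simp [incr, N_eq, count_zero]
  have hcast : Measurable (Nat.cast : ℕ → ℤ) := measurable_from_top
  filter_upwards [h.cond_stat 0 d s d.2, h.cond_poisson d hd,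
    condDistrib_comp Θ (μ := Q) (measurable_N d).aemeasurable hcast] with θ h1 h2 h3
  rw [zero_add, add_comm d s] at h1
  rw [h1, h0, h3, Kernel.map_apply _ hcast, h2]

/-- The conditional probability of a box of grid increments is an explicit function of `Θ` involving
only `g`; the law of the increments is thus fixed by `g` and the law of `Θ`. -/
lemma IsMPP.real_increments {Q : Measure Ω} [IsProbabilityMeasure Q] {g : Pos → Pos}
    (h : IsMPP Q g) {d : ℝ≥0} (hd : 0 < d) {C : Set Pos} (hC : MeasurableSet C) (m : ℕ)
    (B : ℕ → Set ℤ) :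
    Q.real (Θ ⁻¹' C ∩ ⋂ i : Fin m, incr (i * d) (i * d + d) ⁻¹' B i) =
      ∫ ω in Θ ⁻¹' C, ∏ i : Fin m, (poissonInt (d * toNN (g (Θ ω)))).real (B i) ∂Q := by
  set t : Fin (m + 1) → ℝ≥0 := fun i => i * d with ht
  have htm : Monotone t := fun i j hij => by
    simp only [ht]
    gcongr
    exact hij
  have hms : ∀ i : Fin m, t i.succ = i * d + d := fun i => by
    simp only [ht, Fin.val_succ]
    push_cast
    ring
  have hmB : ∀ i : Fin m, MeasurableSet (incr (i * d) (i * d + d) ⁻¹' B i) := fun i =>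
    measurable_incr _ _ MeasurableSet.of_discrete
  have h1 := (iCondIndepFun_iff_condExp_inter_preimage_eq_mul _ _
    fun i => measurable_incr _ _).mp (h.cond_indep m t htm) Finset.univ
      (sets := fun i => B i) fun i _ => MeasurableSet.of_discrete
  simp only [hms] at h1
  have h2 : ∀ᵐ ω ∂Q, ∀ i : Fin m, (Q⟦incr (i * d) (i * d + d) ⁻¹' B i | sigmaΘ⟧) ω =
      (poissonInt (d * toNN (g (Θ ω)))).real (B i) := by
    refine ae_all_iff.mpr fun i => ?_
    filter_upwards [condDistrib_ae_eq_condExp (μ := Q) measurable_Θ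
      (measurable_incr (i * d) (i * d + d)) (s := B i) MeasurableSet.of_discrete,
      ae_of_ae_map measurable_Θ.aemeasurable (h.condDistrib_incr (i * d) hd)] with ω h3 h4
    rw [← h3, h4]
  rw [← setIntegral_condExp_preimage_Θ (MeasurableSet.iInter hmB) hC]
  refine setIntegral_congr_ae (measurable_Θ hC) ?_
  filter_upwards [h1, h2] with ω h3 h4 _
  simp only [Finset.mem_univ, Set.iInter_true] at h3
  refine h3.trans ?_
  rw [Finset.prod_apply]
  exact Finset.prod_congr rfl fun i _ => h4 i

lemma measurable_poissonInt_real {f : Pos → ℝ≥0} (hf : Measurable f) (B : Set ℤ) :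
    Measurable fun θ => (poissonInt (f θ)).real B := by
  refine Measurable.ennreal_toReal ?_
  simp_rw [poissonInt, Measure.map_apply (f := (Nat.cast : ℕ → ℤ)) measurable_from_top
    (MeasurableSet.of_discrete (s := B)), ← Measure.tsum_indicator_apply_singleton
    _ _ (MeasurableSet.of_discrete (s := (Nat.cast : ℕ → ℤ) ⁻¹' B))]
  refine Measurable.tsum fun n => ?_
  by_cases hn : n ∈ (Nat.cast : ℕ → ℤ) ⁻¹' B
  · simp only [Set.indicator_of_mem hn, poissonMeasure_singleton]
    fun_prop
  · simp only [Set.indicator_of_notMem hn, measurable_const]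

lemma measurable_toNN : Measurable toNN := measurable_subtype_coe.subtype_mk

/-- The values of the counting process along a grid. -/
def gridN (d : ℝ≥0) (ω : Ω) (k : ℕ) : ℕ := N (k * d) ω

lemma measurable_gridN (d : ℝ≥0) : Measurable (gridN d) :=
  measurable_pi_lambda _ fun _ => measurable_N _

section Identification

variable {Q Q' : Measure Ω} [IsProbabilityMeasure Q] [IsProbabilityMeasure Q'] {g : Pos → Pos}

lemma IsMPP.map_grid_eq (hg : Measurable g) (h : IsMPP Q g) (h' : IsMPP Q' g)
    (hΘ : Q.map Θ = Q'.map Θ) {d : ℝ≥0} (hd : 0 < d) :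
    Q.map (fun ω => (Θ ω, gridN d ω)) = Q'.map fun ω => (Θ ω, gridN d ω) := by
  set J : Ω → ℕ → ℤ := fun ω i => incr (i * d) (i * d + d) ω with hJ
  have hmJ : Measurable J := measurable_pi_lambda _ fun i => measurable_incr _ _
  have hJeq : Q.map (fun ω => (Θ ω, J ω)) = Q'.map fun ω => (Θ ω, J ω) := by
    have := Measure.isProbabilityMeasure_map (μ := Q) (measurable_Θ.prodMk hmJ).aemeasurable
    refine Measure.ext_prod fun {C D} hC hD => ?_
    rw [Measure.map_apply (measurable_Θ.prodMk hmJ) (hC.prod hD),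
      Measure.map_apply (measurable_Θ.prodMk hmJ) (hC.prod hD), Set.mk_preimage_prod,
      Set.inter_comm, ← Measure.restrict_apply (hmJ hD), ← Measure.restrict_apply (hmJ hD),
      ← Measure.map_apply hmJ hD, ← Measure.map_apply hmJ hD]
    -- With `C` fixed, it remains to compare two finite measures on sequences, for which boxes
    -- suffice.
    congr 1
    refine ext_of_boxes fun m B hB => ?_
    have hbox : MeasurableSet {x : ℕ → ℤ | ∀ i < m, x i ∈ B i} := by
      have : {x : ℕ → ℤ | ∀ i < m, x i ∈ B i} = Set.pi (Finset.range m) B := by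
        ext x
        simp
      rw [this]
      exact MeasurableSet.pi (Finset.countable_toSet _) fun i _ => hB i
    rw [Measure.map_apply hmJ hbox, Measure.map_apply hmJ hbox,
      Measure.restrict_apply (hmJ hbox), Measure.restrict_apply (hmJ hbox), Set.inter_comm]
    have hset : J ⁻¹' {x : ℕ → ℤ | ∀ i < m, x i ∈ B i} =
        ⋂ i : Fin m, incr (i * d) (i * d + d) ⁻¹' B i := by
      ext ω
      simp [hJ, Fin.forall_iff]
    rw [hset, ← measureReal_eq_measureReal_iff, h.real_increments hd hC,
      h'.real_increments hd hC]
    have hprod : Measurable fun θ => ∏ i : Fin m, (poissonInt (d * toNN (g θ))).real (B i) :=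
      Finset.measurable_fun_prod _ fun i _ =>
        measurable_poissonInt_real (measurable_const.mul (measurable_toNN.comp hg)) _
    rw [← setIntegral_map hC hprod.aestronglyMeasurable measurable_Θ.aemeasurable, hΘ,
      setIntegral_map hC hprod.aestronglyMeasurable measurable_Θ.aemeasurable]
  have hsum : ∀ ω k, gridN d ω k = (∑ i ∈ Finset.range k, J ω i).toNat := fun ω k => by
    have : ∑ i ∈ Finset.range k, J ω i = (N (k * d) ω : ℤ) := by
      induction k with
      | zero => simp [N_eq, count_zero]
      | succ k ih =>
        rw [Finset.sum_range_succ, ih]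
        simp only [hJ, incr]
        rw [show ((k + 1 : ℕ) : ℝ≥0) * d = k * d + d by push_cast; ring]
        ring
    rw [this]
    simp [gridN]
  have hmS : Measurable fun p : Pos × (ℕ → ℤ) =>
      (p.1, fun k => (∑ i ∈ Finset.range k, p.2 i).toNat) := by
    refine measurable_fst.prodMk (measurable_pi_lambda _ fun k => ?_)
    exact (measurable_of_countable Int.toNat).comp
      (Finset.measurable_fun_sum _ fun i _ => (measurable_pi_apply i).comp measurable_snd)
  have hcomp : (fun ω => (Θ ω, gridN d ω)) =
      (fun p : Pos × (ℕ → ℤ) => (p.1, fun k => (∑ i ∈ Finset.range k, p.2 i).toNat)) ∘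
        fun ω => (Θ ω, J ω) := by
    funext ω
    refine Prod.ext rfl (funext fun k => hsum ω k)
  rw [hcomp, ← Measure.map_map hmS (measurable_Θ.prodMk hmJ), hJeq,
    Measure.map_map hmS (measurable_Θ.prodMk hmJ)]

/-! ### Recovering the arrival times from dyadic observations -/

/-- The mesh of the dyadic grid of order `n`. -/
def mesh (n : ℕ) : ℝ≥0 := (1 / 2) ^ n

lemma mesh_pos (n : ℕ) : 0 < mesh n := by
  unfold mesh
  positivity

/-- The information contained in the structure parameter and the counting process along the dyadic
grid of order `n`. -/
abbrev dyadicSigma (n : ℕ) : MeasurableSpace Ω :=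
  MeasurableSpace.comap (fun ω => (Θ ω, gridN (mesh n) ω)) inferInstance

lemma dyadicSigma_le (n : ℕ) : dyadicSigma n ≤ (inferInstance : MeasurableSpace Ω) :=
  (measurable_Θ.prodMk (measurable_gridN _)).comap_le

/-- The coarser grid consists of every second point of the finer one. -/
lemma dyadicSigma_mono : Monotone dyadicSigma := by
  refine monotone_nat_of_le_succ fun n => ?_
  have hf : Measurable fun p : Pos × (ℕ → ℕ) => (p.1, fun k => p.2 (2 * k)) :=
    measurable_fst.prodMk (measurable_pi_lambda _ fun k =>
      (measurable_pi_apply (2 * k)).comp measurable_snd)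
  have : (fun ω => (Θ ω, gridN (mesh n) ω)) =
      (fun p : Pos × (ℕ → ℕ) => (p.1, fun k => p.2 (2 * k))) ∘
        fun ω => (Θ ω, gridN (mesh (n + 1)) ω) := by
    funext ω
    refine Prod.ext rfl (funext fun k => ?_)
    simp only [gridN, Function.comp_apply]
    congr 1
    simp only [mesh, pow_succ]
    push_cast
    rw [mul_comm (2 : ℝ≥0) k, mul_assoc, mul_comm _ (1 / 2 : ℝ≥0), ← mul_assoc 2]
    simp
  rw [dyadicSigma, this, ← MeasurableSpace.comap_comp]
  exact MeasurableSpace.comap_mono hf.comap_le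

lemma IsMPP.apply_eq_of_measurableSet_iSup (hg : Measurable g) (h : IsMPP Q g) (h' : IsMPP Q' g)
    (hΘ : Q.map Θ = Q'.map Θ) {A : Set Ω} (hA : MeasurableSet[⨆ n, dyadicSigma n] A) :
    Q A = Q' A := by
  refine ext_on_measurableSpace_of_generate_finite _
    (C := ⋃ n, {s | MeasurableSet[dyadicSigma n] s}) ?_ (iSup_le dyadicSigma_le)
    (MeasurableSpace.generateFrom_iUnion_measurableSet _).symm ?_ ?_ hA
  · intro s hs
    obtain ⟨n, B, hB, rfl⟩ := Set.mem_iUnion.mp hs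
    have hm : Measurable fun ω => (Θ ω, gridN (mesh n) ω) :=
      measurable_Θ.prodMk (measurable_gridN _)
    rw [← Measure.map_apply hm hB, h.map_grid_eq hg h' hΘ (mesh_pos n), Measure.map_apply hm hB]
  · exact isPiSystem_iUnion_of_monotone _ (fun n => (dyadicSigma n).isPiSystem_measurableSet)
      fun m n hmn => dyadicSigma_mono hmn
  · simp

open Classical in
/-- The `j`-th arrival time, reconstructed from the counting process at dyadic times. -/
def dyadicArrival (j : ℕ) (ω : Ω) : ℝ≥0∞ :=
  ⨅ n : ℕ, ⨅ k : ℕ, if j ≤ gridN (mesh n) ω k then ((k * mesh n : ℝ≥0) : ℝ≥0∞) else ⊤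

lemma measurable_dyadicArrival (j : ℕ) :
    Measurable[⨆ n, dyadicSigma n] (dyadicArrival j) := by
  refine Measurable.iInf (mδ := ⨆ n, dyadicSigma n) fun n =>
    Measurable.iInf (mδ := ⨆ n, dyadicSigma n) fun k => ?_
  refine Measurable.ite (?_ : MeasurableSet[⨆ n, dyadicSigma n] _) measurable_const measurable_const
  refine le_iSup dyadicSigma n _ ⟨{p | j ≤ p.2 k}, ?_, rfl⟩
  exact measurableSet_le measurable_const ((measurable_pi_apply k).comp measurable_snd)

lemma exists_dyadic_between {a b : ℝ} (ha : 0 ≤ a) (hab : a < b) :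
    ∃ n k : ℕ, a ≤ k * mesh n ∧ k * mesh n ≤ b := by
  obtain ⟨n, hn⟩ := exists_pow_lt_of_lt_one (sub_pos.mpr hab) (show (1 / 2 : ℝ) < 1 by norm_num)
  have hmesh : ((mesh n : ℝ≥0) : ℝ) = (1 / 2) ^ n := by simp [mesh]
  have hpos : (0 : ℝ) < (1 / 2) ^ n := by positivity
  refine ⟨n, ⌈a / (1 / 2) ^ n⌉₊, ?_, ?_⟩
  · rw [hmesh, ← div_le_iff₀ hpos]
    exact Nat.le_ceil _
  · have := Nat.ceil_lt_add_one (div_nonneg ha hpos.le)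
    rw [hmesh]
    calc (⌈a / (1 / 2) ^ n⌉₊ : ℝ) * (1 / 2) ^ n ≤ (a / (1 / 2) ^ n + 1) * (1 / 2) ^ n := by gcongr
      _ = a + (1 / 2) ^ n := by field_simp
      _ ≤ b := by linarith

/-- Off the explosion `j ≤ N_u` means `T_j ≤ u`, so the infimum runs over the dyadic times at or
after `T_j`, and these are dense. -/
lemma dyadicArrival_eq (j : ℕ) {ω : Ω} (hω : ω ∉ explosion) :
    dyadicArrival j ω = ENNReal.ofReal (arrival j ω.1) := by
  have hle : ∀ n k : ℕ, j ≤ gridN (mesh n) ω k ↔ arrival j ω.1 ≤ k * mesh n := fun n k => by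
    rw [gridN, N_eq, le_count_iff (w := ω.1) hω (k * mesh n) j]
    simp
  apply le_antisymm
  · refine ENNReal.le_of_forall_pos_le_add fun ε hε _ => ?_
    obtain ⟨n, k, h1, h2⟩ := exists_dyadic_between (arrival_nonneg j ω.1)
      (show arrival j ω.1 < arrival j ω.1 + ε by simpa using hε)
    refine (iInf₂_le n k).trans ?_
    rw [if_pos ((hle n k).mpr h1), ← ENNReal.ofReal_coe_nnreal, ← ENNReal.ofReal_coe_nnreal,
      ← ENNReal.ofReal_add (arrival_nonneg j ω.1) ε.coe_nonneg]
    exact ENNReal.ofReal_le_ofReal (by simpa using h2)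
  · refine le_iInf₂ fun n k => ?_
    split_ifs with h
    · rw [← ENNReal.ofReal_coe_nnreal]
      exact ENNReal.ofReal_le_ofReal (by simpa using (hle n k).mp h)
    · exact le_top

/-- The definition of a mixed Poisson process mentions `N` only. Non-explosion is what lets the
interarrival times be recovered from it, as differences of reconstructed arrival times. -/
lemma IsMPP.map_path_eq (hg : Measurable g) (h : IsMPP Q g) (h' : IsMPP Q' g)
    (hΘ : Q.map Θ = Q'.map Θ) (hexp : Q explosion = 0) (hexp' : Q' explosion = 0) {A : Set Path}
    (hA : MeasurableSet A) {C : Set Pos} (hC : MeasurableSet C) :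
    Q (Θ ⁻¹' C ∩ Prod.fst ⁻¹' A) = Q' (Θ ⁻¹' C ∩ Prod.fst ⁻¹' A) := by
  set Y : Ω → Path := fun ω j =>
    toPos ((dyadicArrival (j + 1) ω).toReal - (dyadicArrival j ω).toReal) with hY
  have hmY : Measurable[⨆ n, dyadicSigma n] Y := by
    refine @measurable_pi_lambda _ _ _ (⨆ n, dyadicSigma n) _ _ fun j => ?_
    exact measurable_toPos.comp ((measurable_dyadicArrival (j + 1)).ennreal_toReal.sub
      (measurable_dyadicArrival j).ennreal_toReal)
  have hYeq : ∀ ω, ω ∉ explosion → Y ω = ω.1 := fun ω hω => by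
    funext j
    simp only [hY]
    rw [dyadicArrival_eq _ hω, dyadicArrival_eq _ hω, ENNReal.toReal_ofReal (arrival_nonneg _ _),
      ENNReal.toReal_ofReal (arrival_nonneg _ _), arrival_succ, add_sub_cancel_left, toPos_coe]
  have hcongr : ∀ μ : Measure Ω, μ explosion = 0 →
      μ (Θ ⁻¹' C ∩ Prod.fst ⁻¹' A) = μ (Θ ⁻¹' C ∩ Y ⁻¹' A) := fun μ hμ => by
    refine measure_congr ?_
    have : ∀ᵐ ω ∂μ, ω ∉ explosion := by
      rw [ae_iff]
      simpa using hμ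
    filter_upwards [this] with ω hω
    change (Θ ω ∈ C ∧ ω.1 ∈ A) = (Θ ω ∈ C ∧ Y ω ∈ A)
    rw [hYeq ω hω]
  rw [hcongr Q hexp, hcongr Q' hexp']
  refine h.apply_eq_of_measurableSet_iSup hg h' hΘ (MeasurableSet.inter ?_ (hmY hA))
  exact le_iSup dyadicSigma 0 _ ⟨Prod.fst ⁻¹' C, measurable_fst hC, rfl⟩

/-- Given `Θ` the probability factors by `CondA1`, and `CondA2` makes the factor of the claims
constant, so it can be taken out of the integral over `Θ ⁻¹' C`. -/
lemma apply_box_eq_mul {Q : Measure Ω} [IsProbabilityMeasure Q] (h1 : CondA1 Q) (h2 : CondA2 Q)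
    {A : Set Path} (hA : MeasurableSet A) {B : Set (ℕ → Pos)} (hB : MeasurableSet B) {C : Set Pos}
    (hC : MeasurableSet C) :
    Q (A ×ˢ B ×ˢ C) = Q (Θ ⁻¹' C ∩ Prod.fst ⁻¹' A) * Q ((fun ω n => X n ω) ⁻¹' B) := by
  have hW : Measurable fun (ω : Ω) n => W n ω := measurable_pi_lambda _ measurable_W
  have hX : Measurable fun (ω : Ω) n => X n ω := measurable_pi_lambda _ measurable_X
  have hset : A ×ˢ B ×ˢ C = Θ ⁻¹' C ∩
      ((fun (ω : Ω) n => W n ω) ⁻¹' A ∩ (fun (ω : Ω) n => X n ω) ⁻¹' B) := by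
    ext ω
    change (ω.1 ∈ A ∧ ω.2.1 ∈ B ∧ ω.2.2 ∈ C) ↔ (ω.2.2 ∈ C ∧ ω.1 ∈ A ∧ ω.2.1 ∈ B)
    tauto
  have hci := (condIndepFun_iff_condExp_inter_preimage_eq_mul hW hX).mp h1 A B hA hB
  have hconst : Q⟦(fun (ω : Ω) n => X n ω) ⁻¹' B | sigmaΘ⟧ =ᵐ[Q]
      fun _ => Q.real ((fun (ω : Ω) n => X n ω) ⁻¹' B) := by
    have := condExp_indep_eq hX.comap_le sigmaΘ_le (μ := Q)
      (f := ((fun (ω : Ω) n => X n ω) ⁻¹' B).indicator fun _ => (1 : ℝ))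
      (stronglyMeasurable_const.indicator ⟨B, hB, rfl⟩) h2.symm
    rw [integral_indicator (hX hB)] at this
    simpa using this
  rw [hset, ← ENNReal.toReal_eq_toReal_iff' (measure_ne_top _ _)
    (ENNReal.mul_ne_top (measure_ne_top _ _) (measure_ne_top _ _)), ENNReal.toReal_mul,
    ← measureReal_def, ← measureReal_def, ← measureReal_def,
    ← setIntegral_condExp_preimage_Θ ((hW hA).inter (hX hB)) hC,
    ← setIntegral_condExp_preimage_Θ (measurable_fst hA) hC, ← integral_mul_const]
  refine setIntegral_congr_ae (measurable_Θ hC) ?_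
  filter_upwards [hci, hconst] with ω h3 h4 _
  rw [h3, h4]
  rfl

lemma IsRiskProcess.map_claims (h : IsRiskProcess Q) :
    Q.map (fun ω n => X n ω) = Measure.infinitePi fun _ : ℕ => Q.map (X 0) := by
  rw [(iIndepFun_iff_map_fun_eq_infinitePi_map measurable_X).mp h.indep_sizes]
  congr 1
  funext n
  exact (h.ident_sizes n).map_eq

/-- The defining properties of the class `M_{S,g}` determine a measure up to the laws of the
structure parameter and of the claim size. -/
lemma eq_of_isCMPP (hg : Measurable g) (h : IsCMPP Q g) (h' : IsCMPP Q' g) (h1 : CondA1 Q)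
    (h1' : CondA1 Q') (h2 : CondA2 Q) (h2' : CondA2 Q') (hΘ : Q.map Θ = Q'.map Θ)
    (hX : Q.map (X 0) = Q'.map (X 0)) : Q = Q' := by
  have hmX : Measurable fun (ω : Ω) n => X n ω := measurable_pi_lambda _ measurable_X
  refine Measure.ext_prod₃ fun {A B C} hA hB hC => ?_
  rw [apply_box_eq_mul h1 h2 hA hB hC, apply_box_eq_mul h1' h2' hA hB hC,
    h.2.map_path_eq hg h'.2 hΘ h.1.explosion_null h'.1.explosion_null hA hC,
    ← Measure.map_apply hmX hB, ← Measure.map_apply hmX hB, h.1.map_claims, h'.1.map_claims]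
  simp_rw [hX]

end Identification

instance isProbabilityMeasure_map_Θ (Q : Measure Ω) [IsProbabilityMeasure Q] :
    IsProbabilityMeasure (Q.map Θ) :=
  Measure.isProbabilityMeasure_map measurable_Θ.aemeasurable

instance isProbabilityMeasure_map_X (Q : Measure Ω) [IsProbabilityMeasure Q] (n : ℕ) :
    IsProbabilityMeasure (Q.map (X n)) :=
  Measure.isProbabilityMeasure_map (measurable_X n).aemeasurable

/-- The members of the class `M_{S,g}` are mixtures of the fibre measures. -/
lemma eq_mixture_of_mem_classM {P Q : ProbabilityMeasure Ω} {g : Pos → Pos} (hg : Measurable g)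
    (hQ : Q ∈ classM P g) :
    (Q : Measure Ω) = mixture hg ((Q : Measure Ω).map (X 0)) ((Q : Measure Ω).map Θ) := by
  obtain ⟨h1, h2, _, h3⟩ := hQ
  refine eq_of_isCMPP hg h3 ⟨isRiskProcess_mixture hg _ _, isMPP_mixture hg _ _⟩ h1
    (condA1_mixture hg _ _) h2 (condA2_mixture hg _ _) ?_ ?_
  · rw [map_Θ_mixture]
  · rw [map_mixture_of_forall hg _ _ (measurable_X 0) fun θ => map_X_fib _ _ θ 0]

/-! ### Real densities -/

section Density

variable {α : Type*} [MeasurableSpace α] {μ ν : Measure α}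

lemma isProbabilityMeasure_withDensity_ofReal {f : α → ℝ} (hf : 0 ≤ᵐ[μ] f)
    (h : ∫ x, f x ∂μ = 1) :
    IsProbabilityMeasure (μ.withDensity fun x => ENNReal.ofReal (f x)) := by
  have hint : Integrable f μ := by
    by_contra hn
    rw [integral_undef hn] at h
    exact zero_ne_one h
  constructor
  rw [withDensity_apply _ MeasurableSet.univ, setLIntegral_univ,
    ← ofReal_integral_eq_lintegral_ofReal hint hf, h, ENNReal.ofReal_one]

lemma integral_eq_one_of_withDensity_ofReal {f : α → ℝ} (hm : Measurable f) (hf : 0 ≤ᵐ[μ] f)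
    (h : IsProbabilityMeasure (μ.withDensity fun x => ENNReal.ofReal (f x))) :
    ∫ x, f x ∂μ = 1 := by
  have h1 := h.measure_univ
  rw [withDensity_apply _ MeasurableSet.univ, setLIntegral_univ] at h1
  rw [integral_eq_lintegral_of_nonneg_ae hf hm.aestronglyMeasurable, h1, ENNReal.toReal_one]

lemma ae_eq_of_withDensity_ofReal {f g : α → ℝ} (hf : Measurable f) (hg : Measurable g)
    (hf0 : 0 ≤ᵐ[μ] f) (hg0 : 0 ≤ᵐ[μ] g)
    [IsFiniteMeasure (μ.withDensity fun x => ENNReal.ofReal (f x))]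
    (h : (μ.withDensity fun x => ENNReal.ofReal (f x)) =
      μ.withDensity fun x => ENNReal.ofReal (g x)) : f =ᵐ[μ] g := by
  have hfin : ∫⁻ x, ENNReal.ofReal (f x) ∂μ ≠ ⊤ := by
    rw [← setLIntegral_univ, ← withDensity_apply _ MeasurableSet.univ]
    exact measure_ne_top _ _
  have h1 := (withDensity_eq_iff hf.ennreal_ofReal.aemeasurable hg.ennreal_ofReal.aemeasurable
    hfin).mp h
  filter_upwards [h1, hf0, hg0] with x h2 h3 h4
  exact (ENNReal.ofReal_eq_ofReal_iff h3 h4).mp h2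

lemma integrable_withDensity_ofReal {f φ : α → ℝ} (hf : Measurable f) (hf0 : 0 ≤ᵐ[μ] f) :
    Integrable φ (μ.withDensity fun x => ENNReal.ofReal (f x)) ↔
      Integrable (fun x => φ x * f x) μ := by
  rw [integrable_withDensity_iff_integrable_smul' hf.ennreal_ofReal (by simp)]
  refine integrable_congr ?_
  filter_upwards [hf0] with x hx
  rw [ENNReal.toReal_ofReal hx, smul_eq_mul, mul_comm]

lemma exists_pos_density [SigmaFinite μ] [SigmaFinite ν] (h1 : ν ≪ μ) (h2 : μ ≪ ν) :
    ∃ f : α → ℝ, Measurable f ∧ (∀ x, 0 ≤ f x) ∧ (∀ᵐ x ∂μ, 0 < f x) ∧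
      ν = μ.withDensity fun x => ENNReal.ofReal (f x) := by
  refine ⟨fun x => (ν.rnDeriv μ x).toReal, (Measure.measurable_rnDeriv ν μ).ennreal_toReal,
    fun x => ENNReal.toReal_nonneg, ?_, ?_⟩
  · filter_upwards [Measure.rnDeriv_pos' h2, Measure.rnDeriv_lt_top ν μ] with x hx hx'
    exact ENNReal.toReal_pos hx.ne' hx'.ne
  · conv_lhs => rw [← Measure.withDensity_rnDeriv_eq ν μ h1]
    refine withDensity_congr_ae ?_
    filter_upwards [Measure.rnDeriv_lt_top ν μ] with x hx
    rw [ENNReal.ofReal_toReal hx.ne]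

end Density

/-! ### Consequences of progressive equivalence -/

lemma ProgEquiv.of_density {P Q : Measure Ω} (d : ℝ≥0 → Ω → ℝ) (hd : ∀ t, Measurable (d t))
    (hpos : ∀ t, ∀ᵐ ω ∂P, 0 < d t ω)
    (h : ∀ (t : ℝ≥0) (A : Set Ω), MeasurableSet[F t] A →
      Q A = ∫⁻ ω in A, ENNReal.ofReal (d t ω) ∂P) : ProgEquiv Q P := by
  intro t A hA
  rw [h t A hA, lintegral_eq_zero_iff (hd t).ennreal_ofReal]
  constructor
  · intro h0
    have h1 : ∀ᵐ ω ∂P.restrict A, False := by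
      filter_upwards [h0, ae_restrict_of_ae (hpos t)] with ω h2 h3
      exact absurd (ENNReal.ofReal_eq_zero.mp h2) (not_le.mpr h3)
    have h2 : (P.restrict A) Set.univ = 0 := by
      have := ae_iff.mp h1
      simpa using this
    rwa [Measure.restrict_apply_univ] at h2
  · intro h0
    rw [Measure.restrict_eq_zero.mpr h0]
    rfl

/-- `Θ` is already measurable at time `0`. -/
lemma ProgEquiv.map_Θ_absolutelyContinuous {P Q : Measure Ω} (h : ProgEquiv Q P) :
    P.map Θ ≪ Q.map Θ ∧ Q.map Θ ≪ P.map Θ := by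
  have key : ∀ B : Set Pos, MeasurableSet B → (Q (Θ ⁻¹' B) = 0 ↔ P (Θ ⁻¹' B) = 0) := fun B hB =>
    h 0 _ ((le_sup_right : MeasurableSpace.comap Θ inferInstance ≤ F 0) _ ⟨B, hB, rfl⟩)
  constructor <;> refine Measure.AbsolutelyContinuous.mk fun B hB h0 => ?_ <;>
    rw [Measure.map_apply measurable_Θ hB] at h0 ⊢
  exacts [(key B hB).mp h0, (key B hB).mpr h0]

lemma measurable_S_F {u t : ℝ≥0} (hu : u ≤ t) : Measurable[F t] (S u) := by
  have h1 : MeasurableSpace.comap (S u) inferInstance ≤ F t :=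
    le_sup_of_le_left (le_iSup₂ (f := fun (u : ℝ≥0) (_ : u ≤ t) =>
      MeasurableSpace.comap (S u) inferInstance) u hu)
  exact (comap_measurable (S u)).mono h1 le_rfl

/-! ### Reading the first claim off the aggregate process -/

/-- The points at which the first nonzero value of a family of functions indexed by times in
`[0, t]` is positive and lies in `B`. -/
def firstValueEvent {α ι : Type*} (τ : ι → ℝ≥0) (f : ι → α → ℝ) (t : ℝ≥0) (B : Set Pos) : Set α :=
  ⋃ i, ⋃ _ : τ i ≤ t, (f i ⁻¹' Set.Ioi 0 ∩ (fun a => toPos (f i a)) ⁻¹' B) ∩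
    ⋂ j, ⋂ _ : τ j ≤ τ i, {a | f j a = 0} ∪ {a | f j a = f i a}

lemma mem_firstValueEvent {α ι : Type*} {τ : ι → ℝ≥0} {f : ι → α → ℝ} {t : ℝ≥0} {B : Set Pos}
    {a : α} : a ∈ firstValueEvent τ f t B ↔ ∃ i, τ i ≤ t ∧ (0 < f i a ∧ toPos (f i a) ∈ B) ∧
      ∀ j, τ j ≤ τ i → f j a = 0 ∨ f j a = f i a := by
  simp only [firstValueEvent, Set.mem_iUnion, Set.mem_inter_iff, Set.mem_preimage, Set.mem_Ioi,
    Set.mem_iInter, Set.mem_union, Set.mem_ofPred_eq, exists_prop]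

lemma measurableSet_firstValueEvent {α ι : Type*} [MeasurableSpace α] [Countable ι] {τ : ι → ℝ≥0}
    {f : ι → α → ℝ} {t : ℝ≥0} (hf : ∀ i, τ i ≤ t → Measurable (f i)) {B : Set Pos}
    (hB : MeasurableSet B) : MeasurableSet (firstValueEvent τ f t B) := by
  refine MeasurableSet.iUnion fun i => MeasurableSet.iUnion fun hi => MeasurableSet.inter
    ((hf i hi measurableSet_Ioi).inter (measurable_toPos.comp (hf i hi) hB)) ?_
  refine MeasurableSet.iInter fun j => MeasurableSet.iInter fun hj => ?_
  have hmj := hf j (hj.trans hi)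
  exact (measurableSet_eq_fun hmj measurable_const).union (measurableSet_eq_fun hmj (hf i hi))

/-- The dyadic times. -/
def dyadicTime (p : ℕ × ℕ) : ℝ≥0 := p.2 * mesh p.1

lemma exists_dyadicTime_between {a b : ℝ} (ha : 0 ≤ a) (hab : a < b) :
    ∃ p, a ≤ dyadicTime p ∧ dyadicTime p < b := by
  obtain ⟨n, k, h1, h2⟩ := exists_dyadic_between ha (show a < (a + b) / 2 by linarith)
  refine ⟨(n, k), by simpa [dyadicTime] using h1, ?_⟩
  have : ((dyadicTime (n, k) : ℝ≥0) : ℝ) = k * mesh n := by simp [dyadicTime]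
  linarith

lemma N_eq_one {ω : Ω} {u : ℝ≥0} (h1 : arrival 1 ω.1 ≤ u) (h2 : (u : ℝ) < arrival 2 ω.1) :
    N u ω = 1 := count_of_mem ⟨h1, h2⟩

lemma S_of_N_eq_one {ω : Ω} {u : ℝ≥0} (h : N u ω = 1) : S u ω = X 0 ω := by simp [S, h]

/-- Some dyadic time between the first two arrivals shows the value `X 0`. Had two claims occurred
by the selected time, this earlier nonzero value would differ from the selected one, because claims
are positive. -/
lemma toPos_X_mem_of_mem_firstValueEvent {ω : Ω} (hω : ω ∉ explosion) {t : ℝ≥0} {B : Set Pos}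
    (h : ω ∈ firstValueEvent dyadicTime (fun p => S (dyadicTime p)) t B) : X 0 ω ∈ B := by
  obtain ⟨p, _, ⟨hpos, hB⟩, hfirst⟩ := mem_firstValueEvent.mp h
  have h12 : arrival 1 ω.1 < arrival 2 ω.1 := arrival_strictMono ω.1 Nat.one_lt_two
  have hX : ∀ k, 0 < (X k ω : ℝ) := fun k => (X k ω).2
  have hle : ∀ n, n ≤ N (dyadicTime p) ω ↔ arrival n ω.1 ≤ dyadicTime p := fun n =>
    le_count_iff (w := ω.1) hω (dyadicTime p) n
  have hN1 : 1 ≤ N (dyadicTime p) ω := by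
    by_contra! hlt
    rw [Nat.lt_one_iff] at hlt
    simp [S, hlt] at hpos
  have hN : N (dyadicTime p) ω = 1 := by
    by_contra hne
    have h2 : 2 ≤ N (dyadicTime p) ω := by omega
    obtain ⟨p', h3, h4⟩ := exists_dyadicTime_between (arrival_nonneg 1 ω.1) h12
    have h5 : S (dyadicTime p') ω = X 0 ω := S_of_N_eq_one (N_eq_one h3 h4)
    have h6 : dyadicTime p' ≤ dyadicTime p :=
      NNReal.coe_le_coe.mp (h4.le.trans ((hle 2).mp h2))
    have h7 : (X 0 ω : ℝ) + X 1 ω ≤ S (dyadicTime p) ω := by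
      have := Finset.sum_le_sum_of_subset_of_nonneg (Finset.range_mono h2)
        (f := fun k => (X k ω : ℝ)) fun k _ _ => (hX k).le
      simpa [Finset.sum_range_succ, S] using this
    have h0 := hX 0
    have h1 := hX 1
    rcases hfirst p' h6 with h8 | h8 <;> rw [h5] at h8 <;> linarith
  rw [S_of_N_eq_one hN, toPos_coe] at hB
  exact hB

/-- The extra unit of time leaves room for a dyadic time after the first arrival, which may occur at
`t` itself. -/
lemma mem_firstValueEvent_of_toPos_X_mem {ω : Ω} (hω : ω ∉ explosion) {t : ℝ≥0} {B : Set Pos}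
    (hN : 1 ≤ N t ω) (hB : X 0 ω ∈ B) :
    ω ∈ firstValueEvent dyadicTime (fun p => S (dyadicTime p)) (t + 1) B := by
  have h12 : arrival 1 ω.1 < arrival 2 ω.1 := arrival_strictMono ω.1 Nat.one_lt_two
  have h1t : arrival 1 ω.1 ≤ t := (le_count_iff (w := ω.1) hω t 1).mp hN
  obtain ⟨p, h3, h4⟩ := exists_dyadicTime_between (arrival_nonneg 1 ω.1)
    (lt_min h12 (show arrival 1 ω.1 < ((t + 1 : ℝ≥0) : ℝ) by push_cast; linarith))
  have hp2 := h4.trans_le (min_le_left _ _)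
  have hSp : S (dyadicTime p) ω = X 0 ω := S_of_N_eq_one (N_eq_one h3 hp2)
  refine mem_firstValueEvent.mpr ⟨p, NNReal.coe_le_coe.mp (h4.trans_le (min_le_right _ _)).le,
    ⟨?_, ?_⟩, fun p' hp' => ?_⟩
  · simp only [hSp]
    exact (X 0 ω).2
  · simpa only [hSp, toPos_coe] using hB
  · have hlt : ((dyadicTime p' : ℝ≥0) : ℝ) < arrival 2 ω.1 :=
      (NNReal.coe_le_coe.mpr hp').trans_lt hp2
    by_cases h5 : arrival 1 ω.1 ≤ dyadicTime p'
    · right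
      simp only [hSp]
      exact S_of_N_eq_one (N_eq_one h5 hlt)
    · left
      have h0 : N (dyadicTime p') ω = 0 :=
        count_of_mem (w := ω.1) ⟨by simp [arrival], not_le.mp h5⟩
      simp [S, h0]

lemma exists_measure_one_le_N_ne_zero {P : Measure Ω} [IsProbabilityMeasure P]
    (hexp : P explosion = 0) : ∃ M : ℕ, P {ω | 1 ≤ N M ω} ≠ 0 := by
  by_contra! h
  have h1 : P (explosion ∪ ⋃ M : ℕ, {ω | 1 ≤ N M ω}) = 0 :=
    measure_union_null hexp (measure_iUnion_null h)
  have h2 : explosion ∪ ⋃ M : ℕ, {ω | 1 ≤ N M ω} = Set.univ := by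
    refine Set.eq_univ_of_forall fun ω => ?_
    by_cases hω : ω ∈ explosion
    · exact Or.inl hω
    · obtain ⟨M, hM⟩ := exists_nat_ge (arrival 1 ω.1)
      exact Or.inr (Set.mem_iUnion.mpr
        ⟨M, (le_count_iff (w := ω.1) hω M 1).mpr (by simpa using hM)⟩)
  rw [h2, measure_univ] at h1
  exact one_ne_zero h1

/-- The event that the first nonzero value of `S` lies in `B` belongs to a single `F t`. Under `P`
it contains, up to a null set, the intersection of `{X 0 ∈ B}` with an independent event of positive
probability, namely that a claim has occurred by time `M`. -/
lemma map_X_absolutelyContinuous {P Q : Measure Ω} [IsProbabilityMeasure P]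
    (hP : IsRiskProcess P) (hQ : IsRiskProcess Q)
    (h : ∀ (t : ℝ≥0) (A : Set Ω), MeasurableSet[F t] A → Q A = 0 → P A = 0) :
    P.map (X 0) ≪ Q.map (X 0) := by
  refine Measure.AbsolutelyContinuous.mk fun B hB h0 => ?_
  rw [Measure.map_apply (measurable_X 0) hB] at h0 ⊢
  obtain ⟨M, hM⟩ := exists_measure_one_le_N_ne_zero hP.explosion_null
  set A : Set Ω := firstValueEvent dyadicTime (fun p => S (dyadicTime p)) (M + 1) B with hA
  have hmA : MeasurableSet[F (M + 1)] A :=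
    @measurableSet_firstValueEvent _ _ (F (M + 1)) _ _ _ _ (fun p hp => measurable_S_F hp) _ hB
  have hQA : Q A = 0 := by
    refine measure_mono_null (fun ω hω => ?_) (measure_union_null hQ.explosion_null h0)
    by_cases hexp : ω ∈ explosion
    exacts [Or.inl hexp, Or.inr (toPos_X_mem_of_mem_firstValueEvent hexp hω)]
  have hPA := h _ A hmA hQA
  have hinter : P ({ω | 1 ≤ N M ω} ∩ X 0 ⁻¹' B) = 0 := by
    refine measure_mono_null (fun ω hω => ?_) (measure_union_null hP.explosion_null hPA)
    by_cases hexp : ω ∈ explosion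
    exacts [Or.inl hexp, Or.inr (mem_firstValueEvent_of_toPos_X_mem hexp hω.1 hω.2)]
  have hind : IndepFun (N M) (X 0) P :=
    hP.indep.comp (measurable_pi_apply (M : ℝ≥0)) (measurable_pi_apply 0)
  rw [show {ω | 1 ≤ N (M : ℝ≥0) ω} = N M ⁻¹' Set.Ici 1 from rfl,
    hind.measure_inter_preimage_eq_mul _ _ MeasurableSet.of_discrete hB] at hinter
  exact (mul_eq_zero.mp hinter).resolve_left hM

/-! ### Densities of mixtures -/

lemma ae_Θ_eq_fib (c : Pos) (ν : Measure Pos) [IsProbabilityMeasure ν] (θ : Pos) :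
    ∀ᵐ ω ∂fib c ν θ, Θ ω = θ := by
  have h : ∀ᵐ θ' ∂(fib c ν θ).map Θ, θ' = θ := by
    rw [map_Θ_fib, ae_dirac_eq]
    exact Filter.mem_pure.mpr rfl
  exact ae_of_ae_map measurable_Θ.aemeasurable h

/-- The fibrewise density formula integrated over `θ`: in the fibre of `θ` one has `Θ = θ` almost
surely, so the random parameter in the density may be replaced by `θ`. -/
lemma mixture_apply_of_measurableSet_F {P : ProbabilityMeasure Ω} (b : ClassF P)
    {μ ν π : Measure Pos} [IsProbabilityMeasure μ] [IsProbabilityMeasure ν]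
    (hν : ν = μ.withDensity fun x => ENNReal.ofReal (Real.exp (b.γ x))) {ξ : Pos → ℝ}
    (hξ : Measurable ξ) {t : ℝ≥0} {A : Set Ω} (hA : MeasurableSet[F t] A) :
    mixture b.measurable_param ν (π.withDensity fun θ => ENNReal.ofReal (ξ θ)) A =
      ∫⁻ ω in A, ENNReal.ofReal (ξ (Θ ω) * b.density t (Θ ω) ω) ∂mixture measurable_id μ π := by
  have hmA : MeasurableSet A := F_le t A hA
  have hm1 : Measurable fun θ => fib (b.param θ) ν θ A := by
    simp_rw [← fibKernel_apply b.measurable_param ν]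
    exact Kernel.measurable_coe _ hmA
  have hm2 : Measurable (A.indicator fun ω => ENNReal.ofReal (ξ (Θ ω) * b.density t (Θ ω) ω)) :=
    ((hξ.comp measurable_Θ).mul (b.measurable_density_Θ t)).ennreal_ofReal.indicator hmA
  have hm3 (θ : Pos) : Measurable (A.indicator fun ω => ENNReal.ofReal (b.density t θ ω)) :=
    (b.measurable_density t θ).ennreal_ofReal.indicator hmA
  rw [mixture_apply _ _ _ hmA, lintegral_withDensity_eq_lintegral_mul _ hξ.ennreal_ofReal hm1,
    ← lintegral_indicator hmA, Measure.lintegral_bind (Kernel.aemeasurable _) hm2.aemeasurable]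
  refine lintegral_congr fun θ => ?_
  rw [Pi.mul_apply, fibKernel_apply, fib_apply_of_measurableSet_F b hν θ hA,
    ← lintegral_indicator hmA, ← lintegral_const_mul _ (hm3 θ)]
  refine lintegral_congr_ae ?_
  filter_upwards [ae_Θ_eq_fib θ μ θ] with ω hω
  by_cases h : ω ∈ A
  · rw [Set.indicator_of_mem h, Set.indicator_of_mem h, hω,
      ENNReal.ofReal_mul' (by exact (Real.exp_pos _).le)]
  · rw [Set.indicator_of_notMem h, Set.indicator_of_notMem h, mul_zero]

section Conditions

variable {P Q : ProbabilityMeasure Ω} {b : ClassF P} {g : Pos → Pos} {ξ : Pos → ℝ}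

/-- At time `0` the exponential factor is `1`, which leaves `ξ` as the density of `Q_Θ`. -/
lemma MXi.map_Θ (h : MXi Q b ξ) (hξ : Measurable ξ) :
    (Q : Measure Ω).map Θ =
      ((P : Measure Ω).map Θ).withDensity fun θ => ENNReal.ofReal (ξ θ) := by
  ext B hB
  have h1 := h 0 0 le_rfl _ ((le_sup_right : MeasurableSpace.comap Θ inferInstance ≤ F 0) _
    ⟨B, hB, rfl⟩)
  rw [Measure.map_apply measurable_Θ hB, h1, withDensity_apply _ hB,
    setLIntegral_map hB hξ.ennreal_ofReal measurable_Θ]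
  simp_rw [b.density_zero, mul_one]

/-- The first part of `(**)` holds at every point and `Θ` is onto, so `g` is determined everywhere
and not merely almost everywhere. -/
lemma StarStar.eq_param (h : StarStar g Q b) : g = b.param :=
  funext fun θ => Subtype.ext (h.1 (fun _ => θ, fun _ => θ, θ))

lemma StarStar.map_X (h : StarStar g Q b) :
    (Q : Measure Ω).map (X 0) =
      ((P : Measure Ω).map (X 0)).withDensity fun x => ENNReal.ofReal (Real.exp (b.γ x)) := by
  obtain ⟨f, hf, hpos, hγ⟩ := h.2
  rw [hf.2.2]
  refine withDensity_congr_ae ?_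
  filter_upwards [hpos] with x hx
  rw [hγ x hx, Real.exp_log hx]

lemma ClassF.integral_exp_γ (b : ClassF P) :
    ∫ x, Real.exp (b.γ x) ∂((P : Measure Ω).map (X 0)) = 1 := by
  have hγ : Measurable fun x => Real.exp (b.γ x) := Real.measurable_exp.comp b.measurable_γ
  rw [integral_map (measurable_X 0).aemeasurable hγ.aestronglyMeasurable]
  exact b.normalized

lemma ClassF.isProbabilityMeasure_withDensity (b : ClassF P) : IsProbabilityMeasure
    (((P : Measure Ω).map (X 0)).withDensity fun x => ENNReal.ofReal (Real.exp (b.γ x))) :=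
  isProbabilityMeasure_withDensity_ofReal (ae_of_all _ fun _ => (Real.exp_pos _).le)
    b.integral_exp_γ

lemma ClassF.memL_iff (b : ClassF P) {ℓ : ℕ}
    (h : (Q : Measure Ω).map (X 0) =
      ((P : Measure Ω).map (X 0)).withDensity fun x => ENNReal.ofReal (Real.exp (b.γ x))) :
    b.MemL ℓ ↔ Integrable (fun ω => (X 0 ω : ℝ) ^ ℓ) (Q : Measure Ω) := by
  have hm : Measurable fun x : Pos => (x : ℝ) ^ ℓ := measurable_subtype_coe.pow_const ℓ
  have hγ : Measurable fun x => Real.exp (b.γ x) := Real.measurable_exp.comp b.measurable_γ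
  have hmul : Measurable fun x : Pos => (x : ℝ) ^ ℓ * Real.exp (b.γ x) := hm.mul hγ
  have h1 := integrable_map_measure (μ := (Q : Measure Ω)) hm.aestronglyMeasurable
    (measurable_X 0).aemeasurable
  rw [h, integrable_withDensity_ofReal hγ (ae_of_all _ fun _ => (Real.exp_pos _).le),
    integrable_map_measure hmul.aestronglyMeasurable (measurable_X 0).aemeasurable] at h1
  exact h1

lemma integrable_pow_Θ_iff (hg : Measurable g) (hξ : Measurable ξ)
    (hξ0 : ∀ᵐ θ ∂((P : Measure Ω).map Θ), 0 ≤ ξ θ) {ℓ : ℕ}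
    (h : (Q : Measure Ω).map Θ =
      ((P : Measure Ω).map Θ).withDensity fun θ => ENNReal.ofReal (ξ θ)) :
    Integrable (fun ω => ξ (Θ ω) * (g (Θ ω) : ℝ) ^ ℓ) (P : Measure Ω) ↔
      Integrable (fun ω => (g (Θ ω) : ℝ) ^ ℓ) (Q : Measure Ω) := by
  have hm : Measurable fun θ : Pos => (g θ : ℝ) ^ ℓ := (measurable_subtype_coe.comp hg).pow_const ℓ
  have hmul : Measurable fun θ : Pos => (g θ : ℝ) ^ ℓ * ξ θ := hm.mul hξ
  have h1 := integrable_map_measure (μ := (Q : Measure Ω)) hm.aestronglyMeasurable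
    measurable_Θ.aemeasurable
  rw [h, integrable_withDensity_ofReal hξ hξ0,
    integrable_map_measure hmul.aestronglyMeasurable measurable_Θ.aemeasurable] at h1
  simp_rw [mul_comm (ξ _)]
  exact h1

lemma MXi_of_eq_mixture (hP : P ∈ classM P id) (hg : Measurable g) (hQ : Q ∈ classM P g)
    (hgb : g = b.param)
    (hX : (Q : Measure Ω).map (X 0) =
      ((P : Measure Ω).map (X 0)).withDensity fun x => ENNReal.ofReal (Real.exp (b.γ x)))
    (hξ : Measurable ξ)
    (hΘ : (Q : Measure Ω).map Θ =
      ((P : Measure Ω).map Θ).withDensity fun θ => ENNReal.ofReal (ξ θ)) : MXi Q b ξ := by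
  subst hgb
  intro s t hst A hA
  have h1 := mixture_apply_of_measurableSet_F b (π := (P : Measure Ω).map Θ) hX hξ
    (F_mono hst A hA)
  rw [← hΘ, ← eq_mixture_of_mem_classM hg hQ, ← eq_mixture_of_mem_classM measurable_id hP] at h1
  exact h1

lemma classRStar.integral_map {ℓ : ℕ} (h : ξ ∈ classRStar P g ℓ) :
    ∫ θ, ξ θ ∂((P : Measure Ω).map Θ) = 1 := by
  rw [MeasureTheory.integral_map measurable_Θ.aemeasurable h.1.aestronglyMeasurable]
  exact h.2.2.1

/-! ### The measure determined by a density -/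

lemma exists_mem_classMStar {ℓ : ℕ} (hP : P ∈ classM P id) (b : ClassF P) (hb : b.MemL ℓ)
    (hξ : ξ ∈ classRStar P b.param ℓ) :
    ∃ Q : ProbabilityMeasure Ω, Q ∈ classMStar P b.param ℓ ∧ StarStar b.param Q b ∧ MXi Q b ξ := by
  have hν := b.isProbabilityMeasure_withDensity
  set ν := ((P : Measure Ω).map (X 0)).withDensity fun x => ENNReal.ofReal (Real.exp (b.γ x))
    with hνdef
  have hξ0 : ∀ᵐ θ ∂((P : Measure Ω).map Θ), 0 ≤ ξ θ := hξ.2.1.mono fun _ h => h.le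
  have hπ := isProbabilityMeasure_withDensity_ofReal hξ0 (classRStar.integral_map hξ)
  set π := ((P : Measure Ω).map Θ).withDensity fun θ => ENNReal.ofReal (ξ θ) with hπdef
  have hg := b.measurable_param
  let Q : ProbabilityMeasure Ω := ⟨mixture hg ν π, inferInstance⟩
  -- The witness has rate `b.param`, claim law `exp γ dP_{X_1}` and mixing law `ξ dP_Θ`, so both
  -- marginals hold by construction.
  have hQΘ : (Q : Measure Ω).map Θ = π := map_Θ_mixture hg ν π
  have hQX : (Q : Measure Ω).map (X 0) = ν :=
    map_mixture_of_forall hg ν π (measurable_X 0) fun θ => map_X_fib _ ν θ 0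
  have hden : ∀ (t : ℝ≥0) (A : Set Ω), MeasurableSet[F t] A → (Q : Measure Ω) A =
      ∫⁻ ω in A, ENNReal.ofReal (ξ (Θ ω) * b.density t (Θ ω) ω) ∂(P : Measure Ω) := by
    intro t A hA
    have h1 := mixture_apply_of_measurableSet_F b (π := (P : Measure Ω).map Θ) hνdef hξ.1 hA
    rwa [← eq_mixture_of_mem_classM measurable_id hP] at h1
  have hequiv : ProgEquiv (Q : Measure Ω) P := by
    refine ProgEquiv.of_density (fun t ω => ξ (Θ ω) * b.density t (Θ ω) ω)
      (fun t => (hξ.1.comp measurable_Θ).mul (b.measurable_density_Θ t)) (fun t => ?_) hden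
    filter_upwards [ae_of_ae_map measurable_Θ.aemeasurable hξ.2.1] with ω hω
    exact mul_pos hω (Real.exp_pos _)
  have hQ : Q ∈ classM P b.param := ⟨condA1_mixture hg ν π, condA2_mixture hg ν π, hequiv,
    isRiskProcess_mixture hg ν π, isMPP_mixture hg ν π⟩
  refine ⟨Q, ⟨hQ, (b.memL_iff hQX).mp hb,
    (integrable_pow_Θ_iff hg hξ.1 hξ0 hQΘ).mp hξ.2.2.2⟩, ⟨fun ω => rfl, fun x => Real.exp (b.γ x),
    ⟨Real.measurable_exp.comp b.measurable_γ, ae_of_all _ fun x => (Real.exp_pos _).le, hQX⟩,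
    ae_of_all _ fun x => Real.exp_pos _, fun x _ => (Real.log_exp _).symm⟩,
    MXi_of_eq_mixture hP hg hQ rfl hQX hξ.1 hQΘ⟩

lemma eq_of_starStar_of_MXi {Q' : ProbabilityMeasure Ω} (hg : Measurable g) (hQ : Q ∈ classM P g)
    (hQ' : Q' ∈ classM P g) (hξ : Measurable ξ) (h : StarStar g Q b) (h' : StarStar g Q' b)
    (hM : MXi Q b ξ) (hM' : MXi Q' b ξ) : Q = Q' := by
  have heq : (Q : Measure Ω) = Q' :=
    eq_of_isCMPP hg hQ.2.2.2 hQ'.2.2.2 hQ.1 hQ'.1 hQ.2.1 hQ'.2.1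
      ((hM.map_Θ hξ).trans (hM'.map_Θ hξ).symm) (h.map_X.trans h'.map_X.symm)
  exact Subtype.ext heq

/-! ### The densities determined by a measure -/

lemma exists_density_of_mem_classMStar {ℓ : ℕ} (hP : P ∈ classM P id) (hg : Measurable g)
    (hQ : Q ∈ classMStar P g ℓ) :
    ∃ (b : ClassF P) (ξ : Pos → ℝ), b.MemL ℓ ∧ ξ ∈ classRStar P g ℓ ∧
      IsRNDeriv ξ ((Q : Measure Ω).map Θ) ((P : Measure Ω).map Θ) ∧ StarStar g Q b ∧ MXi Q b ξ := by
  have hequiv := hQ.1.2.2.1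
  have hQR := hQ.1.2.2.2.1
  have hPR := hP.2.2.2.1
  obtain ⟨f, hf, hf0, hfpos, hfd⟩ := exists_pos_density
    (map_X_absolutelyContinuous hQR hPR fun t A hA => (hequiv t A hA).mpr)
    (map_X_absolutelyContinuous hPR hQR fun t A hA => (hequiv t A hA).mp)
  obtain ⟨ξ, hξ, hξ0, hξpos, hξd⟩ := exists_pos_density hequiv.map_Θ_absolutelyContinuous.2
    hequiv.map_Θ_absolutelyContinuous.1
  have hexp : (fun x => Real.exp (Real.log (f x))) =ᵐ[(P : Measure Ω).map (X 0)] f := by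
    filter_upwards [hfpos] with x hx
    exact Real.exp_log hx
  have hint1 : ∫ x, f x ∂((P : Measure Ω).map (X 0)) = 1 :=
    integral_eq_one_of_withDensity_ofReal hf (ae_of_all _ hf0) (hfd ▸ inferInstance)
  let b : ClassF P :=
    -- `(**)` forces this `α`. In `γ` the default value `Real.log 0 = 0` occurs only on the null set
    -- where `f` vanishes.
    { α := fun θ => Real.log (g θ / θ)
      γ := fun x => Real.log (f x)
      measurable_α := Real.measurable_log.comp
        ((measurable_subtype_coe.comp hg).div measurable_subtype_coe)
      measurable_γ := Real.measurable_log.comp hf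
      normalized := by
        rw [← integral_map (f := fun x => Real.exp (Real.log (f x))) (measurable_X 0).aemeasurable
          (Real.measurable_exp.comp (Real.measurable_log.comp hf)).aestronglyMeasurable,
          integral_congr_ae hexp, hint1] }
  have hstar : StarStar g Q b := by
    refine ⟨fun ω => ?_, f, ⟨hf, ae_of_all _ hf0, hfd⟩, hfpos, fun x _ => rfl⟩
    have h1 : (0 : ℝ) < Θ ω := (Θ ω).2
    have h2 : (0 : ℝ) < g (Θ ω) := (g (Θ ω)).2
    change (g (Θ ω) : ℝ) = Θ ω * Real.exp (Real.log (g (Θ ω) / Θ ω))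
    rw [Real.exp_log (div_pos h2 h1), mul_div_cancel₀ _ h1.ne']
  refine ⟨b, ξ, (b.memL_iff hstar.map_X).mpr hQ.2.1, ⟨hξ, hξpos, ?_,
    (integrable_pow_Θ_iff hg hξ (ae_of_all _ hξ0) hξd).mpr hQ.2.2⟩,
    ⟨hξ, ae_of_all _ hξ0, hξd⟩, hstar,
    MXi_of_eq_mixture hP hg hQ.1 hstar.eq_param hstar.map_X hξ hξd⟩
  rw [← integral_map (f := ξ) measurable_Θ.aemeasurable hξ.aestronglyMeasurable]
  exact integral_eq_one_of_withDensity_ofReal hξ (ae_of_all _ hξ0) (hξd ▸ inferInstance)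

/-- The two `α` coincide everywhere, being determined by `g`; the two `γ` coincide almost
everywhere, being logarithms of densities of the same law. -/
lemma β_ae_eq_of_starStar {b' : ClassF P} (h : StarStar g Q b) (h' : StarStar g Q b') :
    b'.β =ᵐ[((P : Measure Ω).map (X 0)).prod ((P : Measure Ω).map Θ)] b.β := by
  have hα : b'.α = b.α := funext fun θ => by
    have h1 : b'.param θ = b.param θ := by rw [← h.eq_param, ← h'.eq_param]
    have h2 : (θ : ℝ) * Real.exp (b'.α θ) = θ * Real.exp (b.α θ) := congrArg Subtype.val h1
    exact Real.exp_injective (mul_left_cancel₀ (ne_of_gt θ.2) h2)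
  have hγ : b'.γ =ᵐ[(P : Measure Ω).map (X 0)] b.γ := by
    have := b'.isProbabilityMeasure_withDensity
    have h1 := ae_eq_of_withDensity_ofReal (f := fun x => Real.exp (b'.γ x))
      (g := fun x => Real.exp (b.γ x)) (Real.measurable_exp.comp b'.measurable_γ)
      (Real.measurable_exp.comp b.measurable_γ) (ae_of_all _ fun _ => (Real.exp_pos _).le)
      (ae_of_all _ fun _ => (Real.exp_pos _).le) (h'.map_X.symm.trans h.map_X)
    exact h1.mono fun x hx => Real.exp_injective hx
  filter_upwards [Measure.quasiMeasurePreserving_fst.ae hγ] with p hp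
  rw [ClassF.β, ClassF.β, hα, hp]

lemma ae_eq_of_MXi {ξ' : Pos → ℝ} {b' : ClassF P} (hξ : Measurable ξ) (hξ' : Measurable ξ')
    (hξ0 : ∀ᵐ θ ∂((P : Measure Ω).map Θ), 0 < ξ θ) (hξ0' : ∀ᵐ θ ∂((P : Measure Ω).map Θ), 0 < ξ' θ)
    (h : MXi Q b ξ) (h' : MXi Q b' ξ') : ξ' =ᵐ[(P : Measure Ω).map Θ] ξ := by
  have : IsFiniteMeasure
      (((P : Measure Ω).map Θ).withDensity fun θ => ENNReal.ofReal (ξ' θ)) := by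
    rw [← h'.map_Θ hξ']
    infer_instance
  exact ae_eq_of_withDensity_ofReal hξ' hξ (hξ0'.mono fun _ h => h.le) (hξ0.mono fun _ h => h.le)
    ((h'.map_Θ hξ').symm.trans (h.map_Θ hξ))

/-! ### The fibrewise statement -/

lemma exists_isRCP_of_starStar {ℓ : ℕ} (hP : P ∈ classM P id) {Pk : Kernel Pos Ω}
    (hPk : IsRCP Pk (P : Measure Ω)) (hg : Measurable g) (hQ : Q ∈ classMStar P g ℓ)
    (h : StarStar g Q b) :
    ∃ Qk : Kernel Pos Ω, IsRCP Qk (Q : Measure Ω) ∧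
      (∀ Qk' : Kernel Pos Ω, IsRCP Qk' (Q : Measure Ω) →
        ∀ᵐ θ ∂((P : Measure Ω).map Θ), Qk' θ = Qk θ) ∧
      ∃ V : Set Pos, MeasurableSet V ∧ ((P : Measure Ω).map Θ) V = 0 ∧
        ∀ θ, θ ∉ V → Qk θ ∈ fibreClass (Pk θ) (g θ) ℓ ∧ MTheta (Pk θ) (Qk θ) b θ := by
  set μ := (P : Measure Ω).map (X 0)
  set ν := (Q : Measure Ω).map (X 0)
  have hQk : IsRCP (fibKernel hg ν) (Q : Measure Ω) := by
    have := isRCP_fibKernel hg ν ((Q : Measure Ω).map Θ)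
    rwa [← eq_mixture_of_mem_classM hg hQ.1] at this
  have hPk' : IsRCP (fibKernel measurable_id μ) (P : Measure Ω) := by
    have := isRCP_fibKernel measurable_id μ ((P : Measure Ω).map Θ)
    rwa [← eq_mixture_of_mem_classM measurable_id hP] at this
  -- The chosen r.c.p. of `Q` is explicit and behaves well at every `θ`, so the exceptional set
  -- stems only from the given r.c.p. of `P`. Uniqueness holds `Q_Θ`-almost everywhere and is
  -- transferred by `P_Θ ≪ Q_Θ`.
  refine ⟨fibKernel hg ν, hQk, fun Qk' hQk' =>
    hQ.1.2.2.1.map_Θ_absolutelyContinuous.1.ae_le (hQk'.unique hQk),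
    toMeasurable ((P : Measure Ω).map Θ) {θ | ¬ Pk θ = fibKernel measurable_id μ θ},
    measurableSet_toMeasurable _ _, ?_, fun θ hθ => ?_⟩
  · rw [measure_toMeasurable]
    exact ae_iff.mp (hPk.unique hPk')
  · have hPθ : Pk θ = fib θ μ θ := by
      by_contra hne
      refine hθ (subset_toMeasurable _ _ ?_)
      exact fun h1 => hne (h1.trans (fibKernel_apply measurable_id μ θ))
    have hden : ∀ (t : ℝ≥0) (A : Set Ω), MeasurableSet[F t] A → fib (g θ) ν θ A =
        ∫⁻ ω in A, ENNReal.ofReal (b.density t θ ω) ∂fib θ μ θ := fun t A hA => by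
      have h1 := fib_apply_of_measurableSet_F b h.map_X θ hA
      rwa [← h.eq_param] at h1
    rw [hPθ, fibKernel_apply]
    refine ⟨⟨inferInstance, ProgEquiv.of_density (fun t => b.density t θ)
      (fun t => b.measurable_density t θ) (fun t => ae_of_all _ fun ω => Real.exp_pos _) hden,
      isCPP_fib _ _ _, ?_⟩, fun s t hst A hA => hden t A (F_mono hst A hA)⟩
    have hm : Measurable fun x : Pos => (x : ℝ) ^ ℓ := measurable_subtype_coe.pow_const ℓ
    have h1 := integrable_map_measure (μ := fib (g θ) ν θ) hm.aestronglyMeasurable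
      (measurable_X 0).aemeasurable
    rw [map_X_fib] at h1
    exact h1.mp ((integrable_map_measure hm.aestronglyMeasurable
      (measurable_X 0).aemeasurable).mpr hQ.2.1)

end Conditions

end CMPP

end

theorem corollary4p6 (ℓ : ℕ) (hℓ : ℓ = 1 ∨ ℓ = 2) (P : ProbabilityMeasure CMPP.Ω)
    (hP : P ∈ classMStar P id ℓ) :
    -- (i)
    (∀ (g : Pos → Pos) (Q : ProbabilityMeasure CMPP.Ω), Measurable g → Q ∈ classMStar P g ℓ →
      ∃ (b : ClassF P) (ξ : Pos → ℝ), b.MemL ℓ ∧ ξ ∈ classRStar P g ℓ ∧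
        IsRNDeriv ξ ((Q : Measure CMPP.Ω).map Θ) ((P : Measure CMPP.Ω).map Θ) ∧
        StarStar g Q b ∧ MXi Q b ξ ∧
        ∀ (b' : ClassF P) (ξ' : Pos → ℝ), b'.MemL ℓ → ξ' ∈ classRStar P g ℓ →
          StarStar g Q b' → MXi Q b' ξ' →
          b'.β =ᵐ[((P : Measure CMPP.Ω).map (X 0)).prod ((P : Measure CMPP.Ω).map Θ)] b.β ∧
          ξ' =ᵐ[(P : Measure CMPP.Ω).map Θ] ξ) ∧
    -- (ii)
    (∀ (b : ClassF P) (ξ : Pos → ℝ), b.MemL ℓ → ξ ∈ classRStar P b.param ℓ →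
      ∃! p : (Pos → Pos) × ProbabilityMeasure CMPP.Ω,
        Measurable p.1 ∧ p.2 ∈ classMStar P p.1 ℓ ∧ StarStar p.1 p.2 b ∧ MXi p.2 b ξ) ∧
    -- (iii)
    (∀ Pk : Kernel Pos CMPP.Ω, IsRCP Pk (P : Measure CMPP.Ω) →
      ∀ (g : Pos → Pos) (Q : ProbabilityMeasure CMPP.Ω) (b : ClassF P) (ξ : Pos → ℝ),
        Measurable g → Q ∈ classMStar P g ℓ → b.MemL ℓ → ξ ∈ classRStar P g ℓ →
        StarStar g Q b → MXi Q b ξ →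
        ∃ Qk : Kernel Pos CMPP.Ω, IsRCP Qk (Q : Measure CMPP.Ω) ∧
          (∀ Qk' : Kernel Pos CMPP.Ω, IsRCP Qk' (Q : Measure CMPP.Ω) →
            ∀ᵐ θ ∂((P : Measure CMPP.Ω).map Θ), Qk' θ = Qk θ) ∧
          ∃ V : Set Pos, MeasurableSet V ∧ ((P : Measure CMPP.Ω).map Θ) V = 0 ∧
            ∀ θ, θ ∉ V → Qk θ ∈ fibreClass (Pk θ) (g θ) ℓ ∧ MTheta (Pk θ) (Qk θ) b θ) := by
  refine ⟨fun g Q hg hQ => ?_, fun b ξ hb hξ => ?_, fun Pk hPk g Q b ξ hg hQ _ _ h _ =>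
    exists_isRCP_of_starStar hP.1 hPk hg hQ h⟩
  · obtain ⟨b, ξ, hb, hξ, hd, hstar, hM⟩ := exists_density_of_mem_classMStar hP.1 hg hQ
    exact ⟨b, ξ, hb, hξ, hd, hstar, hM, fun b' ξ' _ hξ' hstar' hM' =>
      ⟨β_ae_eq_of_starStar hstar hstar', ae_eq_of_MXi hξ.1 hξ'.1 hξ.2.1 hξ'.2.1 hM hM'⟩⟩
  · obtain ⟨Q, hQ, hstar, hM⟩ := exists_mem_classMStar hP.1 b hb hξ
    refine ⟨(b.param, Q), ⟨b.measurable_param, hQ, hstar, hM⟩, ?_⟩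
    rintro ⟨g, Q'⟩ ⟨hg, hQ', hstar', hM'⟩
    obtain rfl : g = b.param := hstar'.eq_param
    exact Prod.ext rfl (eq_of_starStar_of_MXi hg hQ'.1 hQ.1 hξ.1 hstar' hstar hM' hM)
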